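/- Let $(A,\mathfrak m)$ be a Gorenstein local ring of dimension $d\ge 1$ (a Noetherian local ring of finite injective dimension over itself). For a maximal Cohen–Macaulay (MCM) $A$-module $M$ (the zero module is counted as MCM) put $$e^T_A(M)=\lim_{n\to\infty}\frac{(d-1)!}{n^{d-1}}\,\ell\left(\operatorname{Tor}^A_1(M,A/\mathfrak m^{n+1})\right),$$ a limit which exists in $\mathbb R$. A class in $\operatorname{Ext}^1_A(M,N)$, represented by $0\to N\to E\to M\to 0$, is called $T$-split if $e^T_A(M)+e^T_A(N)-e^T_A(E)=0$, and $T_A(M,N)\subseteq\operatorname{Ext}^1_A(M,N)$ is the set of $T$-split classes. Let $\underline{\mathrm{CM}}(A)$ be the stable category of MCM $A$-modules: its objects are the MCM $A$-modules, and $\underline{\operatorname{Hom}}_A(M,N)$ is $\operatorname{Hom}_A(M,N)$ modulo the maps that factor through a projective module. For $M$ MCM let $0\to M\to F\to\Omega^{-1}(M)\to 0$ be the co-syzygy sequence: $F$ is free, $M\to F$ is the composite of $M\cong M^{**}$ with the dual of a minimal free cover of $M^*=\operatorname{Hom}_A(M,A)$, and $\Omega^{-1}(M)$ is the cokernel. Sending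 $f\colon M\to N$ to the class $\alpha_f$ of the pushout of this sequence along $f$ induces an isomorphism of $A$-modules $\eta\colon\underline{\operatorname{Hom}}_A(M,N)\cong\operatorname{Ext}^1_A(\Omega^{-1}(M),N)$. Put $\mathcal R(M,N)=\eta^{-1}\bigl(T_A(\Omega^{-1}(M),N)\bigr)$. Then $\mathcal R$ is a relation (two-sided ideal) on $\underline{\mathrm{CM}}(A)$: for all MCM modules $M,N$ the set $\mathcal R(M,N)$ is an $A$-submodule of $\underline{\operatorname{Hom}}_A(M,N)$, and for all MCM modules $M_1,M,N,N_1$, all $u\in\mathcal R(M,N)$, $f\in\underline{\operatorname{Hom}}_A(M_1,M)$ and $g\in\underline{\operatorname{Hom}}_A(N,N_1)$, one has $u\circ f\in\mathcal R(M_1,N)$ and $g\circ u\in\mathcal R(M,N_1)$. -/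

import Mathlib

open CategoryTheory Abelian Filter Topology
open scoped Pointwise

universe u

/-- Gorenstein local ring: a Noetherian local ring of finite injective dimension over itself. -/
class IsGorensteinLocalRing (A : Type u) [CommRing A] : Prop
    extends IsLocalRing A, IsNoetherianRing A where
  finite_injectiveDimension : ∃ n : ℕ, HasInjectiveDimensionLE (ModuleCat.of A A) n

/-- `M` is maximal Cohen-Macaulay: it is finitely generated, and there is an `M`-regular sequence of
length `dim A` in the maximal ideal.  With `IsWeaklyRegular` the zero module is included; for
`M ≠ 0` finitely generated and a sequence in the maximal ideal, weakly regular is the same as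
regular by Nakayama's lemma. -/
def IsMCM {A : Type u} [CommRing A] [IsLocalRing A] (M : ModuleCat.{u} A) : Prop :=
  Module.Finite A M ∧ ∃ rs : List A, (∀ r ∈ rs, r ∈ IsLocalRing.maximalIdeal A) ∧
    (rs.length : WithBot ℕ∞) = ringKrullDim A ∧ RingTheory.Sequence.IsWeaklyRegular M rs

/-- The Krull dimension of `A` as a natural number. -/
noncomputable def dimNat (A : Type u) [CommRing A] : ℕ := ((ringKrullDim A).unbotD 0).toNat

/-- The sequence `(d-1)! / n^(d-1) * ℓ(Tor_1(M, A/𝔪^(n+1)))`, where `d = dim A`. -/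
noncomputable def eTSeq {A : Type u} [CommRing A] [IsLocalRing A] (M : ModuleCat.{u} A) (n : ℕ) :
    ℝ :=
  ((dimNat A - 1).factorial : ℝ) / (n : ℝ) ^ (dimNat A - 1) *
    ((Module.length A (((Tor (ModuleCat.{u} A) 1).obj M).obj
      (ModuleCat.of A (A ⧸ IsLocalRing.maximalIdeal A ^ (n + 1))))).toNat : ℝ)

/-- The invariant `e^T_A(M)`, the limit of `eTSeq M`. -/
noncomputable def eT {A : Type u} [CommRing A] [IsLocalRing A] (M : ModuleCat.{u} A) : ℝ :=
  limUnder atTop (eTSeq M)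

/-- The class `α ∈ Ext^1(M, N)` is `T`-split: it is the class of a short exact sequence
`0 → N → E → M → 0` with `e^T(M) + e^T(N) - e^T(E) = 0`. -/
def IsTSplit {A : Type u} [CommRing A] [IsLocalRing A] {M N : ModuleCat.{u} A} (α : Ext M N 1) :
    Prop :=
  ∃ (E : ModuleCat.{u} A) (i : N ⟶ E) (p : E ⟶ M) (w : i ≫ p = 0)
    (h : (ShortComplex.mk i p w).ShortExact), h.extClass = α ∧ eT M + eT N - eT E = 0

/-- `T_A(M, N)`, the set of `T`-split classes. -/
def tSplitClasses {A : Type u} [CommRing A] [IsLocalRing A] (M N : ModuleCat.{u} A) :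
    Set (Ext M N 1) :=
  {α | IsTSplit α}

/-- The maps `M ⟶ N` that factor through a projective module. -/
def projectiveMaps {A : Type u} [CommRing A] (M N : ModuleCat.{u} A) : Submodule A (M ⟶ N) where
  carrier := {f | ∃ (P : ModuleCat.{u} A) (_ : Projective P) (g : M ⟶ P) (h : P ⟶ N), g ≫ h = f}
  zero_mem' := ⟨ModuleCat.of A A, inferInstance, 0, 0, by simp⟩
  add_mem' := by
    rintro _ _ ⟨P, _, g, h, rfl⟩ ⟨P', _, g', h', rfl⟩
    exact ⟨P ⊞ P', inferInstance, Limits.biprod.lift g g', Limits.biprod.desc h h', by simp⟩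
  smul_mem' := by
    rintro a _ ⟨P, _, g, h, rfl⟩
    exact ⟨P, inferInstance, a • g, h, by simp⟩

/-- The objects of the stable category of `A`: the maximal Cohen-Macaulay modules. -/
structure StableCM (A : Type u) [CommRing A] [IsLocalRing A] where
  /-- the underlying module -/
  obj : ModuleCat.{u} A
  isMCM : IsMCM obj

section
variable {A : Type u} [CommRing A]

/-- The stable Hom module. -/
abbrev StableHom (M N : ModuleCat.{u} A) : Type u := (M ⟶ N) ⧸ projectiveMaps M N

/-- Composition of stable morphisms, induced by the composition of linear maps. -/
def stableComp (M N L : ModuleCat.{u} A) : StableHom M N →ₗ[A] StableHom N L →ₗ[A] StableHom M L :=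
  Submodule.liftQ (projectiveMaps M N)
    { toFun := fun f => Submodule.mapQ (projectiveMaps N L) (projectiveMaps M L)
        (Linear.leftComp A L f) (by
          rintro _ ⟨P, hP, g, h, rfl⟩
          exact ⟨P, hP, f ≫ g, h, by simp⟩)
      map_add' := fun f f' => by
        ext g
        simp
      map_smul' := fun a f => by
        ext g
        simp }
    (by
      rintro _ ⟨P, hP, g, h, rfl⟩
      rw [LinearMap.mem_ker]
      ext k
      refine (Submodule.Quotient.mk_eq_zero _).2 ⟨P, hP, g, h ≫ k, by simp⟩)

theorem stableComp_mk {M N L : ModuleCat.{u} A} (f : M ⟶ N) (g : N ⟶ L) :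
    stableComp M N L (Submodule.Quotient.mk f) (Submodule.Quotient.mk g) =
      Submodule.Quotient.mk (f ≫ g) := rfl

end

section
variable {A : Type u} [CommRing A] [IsLocalRing A]

/-- The stable category of maximal Cohen-Macaulay modules. -/
instance stableCategory : Category (StableCM A) where
  Hom M N := StableHom M.obj N.obj
  id M := Submodule.Quotient.mk (𝟙 M.obj)
  comp f g := stableComp _ _ _ f g
  id_comp f := by
    obtain ⟨f, rfl⟩ := Submodule.Quotient.mk_surjective _ f
    simp [stableComp_mk]
  comp_id f := by
    obtain ⟨f, rfl⟩ := Submodule.Quotient.mk_surjective _ f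
    simp [stableComp_mk]
  assoc f g h := by
    obtain ⟨f, rfl⟩ := Submodule.Quotient.mk_surjective _ f
    obtain ⟨g, rfl⟩ := Submodule.Quotient.mk_surjective _ g
    obtain ⟨h, rfl⟩ := Submodule.Quotient.mk_surjective _ h
    simp [stableComp_mk]

noncomputable instance stablePreadditive : Preadditive (StableCM A) where
  homGroup M N := inferInstanceAs (AddCommGroup (StableHom M.obj N.obj))
  add_comp M N L f f' g := LinearMap.map_add₂ (stableComp M.obj N.obj L.obj) f f' g
  comp_add M N L f g g' := (stableComp M.obj N.obj L.obj f).map_add g g'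

noncomputable instance stableLinear : Linear A (StableCM A) where
  homModule M N := inferInstanceAs (Module A (StableHom M.obj N.obj))
  smul_comp M N L a f g := LinearMap.map_smul₂ (stableComp M.obj N.obj L.obj) a f g
  comp_smul M N L f a g := (stableComp M.obj N.obj L.obj f).map_smul a g

end

/-- A relation (two-sided ideal) `R` on a `k`-linear category: each `R X Y` is a `k`-submodule of
`X ⟶ Y`, and composing a morphism in `R` with any morphism, on either side, gives a morphism
in `R`. -/
structure IsRelation (k : Type*) [CommRing k] {C : Type*} [Category C] [Preadditive C] [Linear k C]
    (R : ∀ X Y : C, Set (X ⟶ Y)) : Prop where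
  zero_mem : ∀ X Y : C, (0 : X ⟶ Y) ∈ R X Y
  add_mem : ∀ (X Y : C) (u v : X ⟶ Y), u ∈ R X Y → v ∈ R X Y → u + v ∈ R X Y
  smul_mem : ∀ (X Y : C) (a : k) (u : X ⟶ Y), u ∈ R X Y → a • u ∈ R X Y
  precomp_mem : ∀ (W X Y : C) (f : W ⟶ X) (u : X ⟶ Y), u ∈ R X Y → f ≫ u ∈ R W Y
  postcomp_mem : ∀ (X Y Z : C) (u : X ⟶ Y) (g : Y ⟶ Z), u ∈ R X Y → u ≫ g ∈ R X Z

section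
variable {A : Type u} [CommRing A] [IsNoetherianRing A]

theorem exists_chain_of_isWeaklyRegular [IsLocalRing A] (rs : List A) :
    ∀ (M : Type u) [AddCommGroup M] [Module A M] [Module.Finite A M],
      (∀ r ∈ rs, r ∈ IsLocalRing.maximalIdeal A) → RingTheory.Sequence.IsWeaklyRegular M rs →
      ∀ p : PrimeSpectrum A, IsAssociatedPrime p.asIdeal M →
        ∃ c : LTSeries (PrimeSpectrum A), c.head = p ∧ c.length = rs.length := by
  induction rs with
  | nil => intro M _ _ _ _ _ p _; exact ⟨RelSeries.singleton _ p, rfl, rfl⟩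
  | cons r rs ih =>
    intro M _ _ _ hm hreg p hp
    obtain ⟨h1, h2⟩ := (RingTheory.Sequence.isWeaklyRegular_cons_iff M r rs).mp hreg
    obtain ⟨-, m, hpm⟩ := isAssociatedPrime_iff.mp hp
    have hm0 : m ≠ 0 := by
      rintro rfl
      apply p.2.ne_top
      rw [hpm]; simp
    have hpm' : ∀ a, a ∈ p.asIdeal ↔ a • m = 0 := by
      intro a; rw [hpm, Submodule.mem_colon_singleton, Submodule.mem_bot]
    let U : Submodule A M := Submodule.torsionBySet A M p.asIdeal
    have hU : ∀ x, x ∈ U ↔ ∀ a ∈ p.asIdeal, a • x = 0 := by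
      intro x; simp [U, Submodule.mem_torsionBySet_iff]
    have hmU : m ∈ U := (hU m).2 fun a ha => (hpm' a).1 ha
    have hex : ∃ x ∈ U, x ∉ r • (⊤ : Submodule A M) := by
      by_contra! hcon
      have hle : U ≤ Ideal.span {r} • U := by
        intro x hx
        obtain ⟨v, -, rfl⟩ := hcon x hx
        refine Submodule.smul_mem_smul (Ideal.mem_span_singleton_self r) ((hU v).2 fun a ha => ?_)
        have := (hU _).1 hx a ha
        apply h1
        simpa [smul_comm a r v] using this
      have : U = ⊥ := Submodule.eq_bot_of_le_smul_of_le_jacobson_bot (Ideal.span {r}) U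
        (IsNoetherian.noetherian U) hle (by
          rw [IsLocalRing.jacobson_eq_maximalIdeal _ bot_ne_top, Ideal.span_singleton_le_iff_mem]
          exact hm r (by simp))
      rw [this] at hmU
      exact hm0 (by simpa using hmU)
    obtain ⟨x, hxU, hx⟩ := hex
    let y : QuotSMulTop r M := Submodule.Quotient.mk x
    have hy : y ≠ 0 := by simpa [y, Submodule.Quotient.mk_eq_zero] using hx
    obtain ⟨q, hq, hyq⟩ := exists_le_isAssociatedPrime_of_isNoetherianRing A y hy
    have hpq : p.asIdeal ≤ q := fun a ha => hyq (by
      rw [Submodule.mem_colon_singleton, Submodule.mem_bot, ← Submodule.Quotient.mk_smul,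
        (hU x).1 hxU a ha, Submodule.Quotient.mk_zero])
    have hrq : r ∈ q := hyq (by
      rw [Submodule.mem_colon_singleton, Submodule.mem_bot, ← Submodule.Quotient.mk_smul,
        Submodule.Quotient.mk_eq_zero]
      exact Submodule.smul_mem_pointwise_smul x r ⊤ trivial)
    have hrp : r ∉ p.asIdeal := fun h => hm0 (h1 (by simpa using (hpm' r).1 h))
    obtain ⟨c, hc, hl⟩ := ih (QuotSMulTop r M) (fun s hs => hm s (by simp [hs])) h2
      ⟨q, hq.isPrime⟩ hq
    have hlt : p < c.head := by
      rw [hc]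
      refine lt_of_le_of_ne hpq ?_
      intro h
      apply hrp
      rw [h]
      exact hrq
    exact ⟨c.cons p hlt, by simp, by simp [hl]⟩

theorem ext_torsion_of_minimalPrime {n : ℕ} [HasInjectiveDimensionLT (ModuleCat.of A A) n]
    (p : Ideal A) (hp : p ∈ minimalPrimes A) (k : ℕ) :
    ∀ (j : ℕ), 1 ≤ j → n ≤ j + k → ∀ (X : Type u) [AddCommGroup X] [Module A X]
      [Module.Finite A X] (e : Ext (ModuleCat.of A X) (ModuleCat.of A A) j),
      ∃ s, s ∉ p ∧ s • e = 0 := by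
  have hpp : p.IsPrime := hp.1.1
  have h1p : (1 : A) ∉ p := (Ideal.ne_top_iff_one p).1 hpp.ne_top
  induction k with
  | zero =>
    intro j _ hj X _ _ _ e
    exact ⟨1, h1p, by rw [e.eq_zero_of_hasInjectiveDimensionLT n (by omega), smul_zero]⟩
  | succ k ih =>
    intro j hj1 hj X _ _ hX
    induction hX using IsNoetherianRing.induction_on_isQuotientEquivQuotientPrime A with
    | subsingleton N =>
      intro e
      refine ⟨1, h1p, ?_⟩
      have hz : Limits.IsZero (ModuleCat.of A N) := ModuleCat.isZero_of_subsingleton _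
      rw [one_smul, ← e.mk₀_id_comp, hz.eq_of_src (𝟙 _) 0, Ext.mk₀_zero, Ext.zero_comp]
    | quotient N q f =>
      intro e
      by_cases hqp : q.1 ≤ p
      · have hqe : q.1 = p := le_antisymm hqp (hp.2 ⟨q.2, bot_le⟩ hqp)
        have hass : p ∈ associatedPrimes A A :=
          Module.associatedPrimes.minimalPrimes_annihilator_subset_associatedPrimes A A (by
            have : Module.annihilator A A = ⊥ := Module.annihilator_eq_bot.2 inferInstance
            rw [this]; exact hp)
        obtain ⟨-, a, ha⟩ := isAssociatedPrime_iff.mp (AssociatedPrimes.mem_iff.mp hass)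
        have ha' : ∀ x, x ∈ p ↔ x * a = 0 := by
          intro x
          rw [ha, Submodule.mem_colon_singleton, Submodule.mem_bot, smul_eq_mul]
        let g0 : (A ⧸ q.1) →ₗ[A] A := Submodule.liftQ q.1 (LinearMap.toSpanSingleton A A a)
          (fun x hx => by
            rw [hqe] at hx
            simpa using (ha' x).1 hx)
        have hg0 : Function.Injective g0 := by
          rw [← LinearMap.ker_eq_bot]
          apply Submodule.ker_liftQ_eq_bot
          intro x hx
          rw [hqe, ha']
          simpa using hx
        let g : N →ₗ[A] A := g0 ∘ₗ f.toLinearMap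
        have hg : Function.Injective g := hg0.comp f.injective
        let S := ModuleCat.shortComplexOfCompEqZero g (LinearMap.range g).mkQ
          g.exact_map_mkQ_range.linearMap_comp_eq_zero
        have hS : S.ShortExact := ModuleCat.shortComplex_shortExact S
          g.exact_map_mkQ_range hg (Submodule.mkQ_surjective _)
        obtain ⟨s, hs, hse⟩ := ih (j + 1) (by omega) (by omega) (A ⧸ LinearMap.range g)
          (hS.extClass.comp e (by omega))
        refine ⟨s, hs, ?_⟩
        rw [← Ext.comp_smul] at hse
        obtain ⟨y, hy⟩ := Ext.contravariant_sequence_exact₁ hS (ModuleCat.of A A)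
          (s • e) (by omega) hse
        have : Projective (S.X₂) := by
          show Projective (ModuleCat.of A A)
          infer_instance
        obtain ⟨j', rfl⟩ : ∃ j', j = j' + 1 := ⟨j - 1, by omega⟩
        rw [← hy, Ext.eq_zero_of_projective y, Ext.comp_zero]
      · obtain ⟨s, hsq, hsp⟩ := Set.not_subset.1 hqp
        refine ⟨s, hsp, ?_⟩
        have hz : s • 𝟙 (ModuleCat.of A N) = 0 := by
          ext x
          show s • x = 0
          apply f.injective
          rw [map_smul, map_zero]
          obtain ⟨b, hb⟩ := Ideal.Quotient.mk_surjective (f x)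
          rw [← hb, Algebra.smul_def, Ideal.Quotient.algebraMap_eq, ← map_mul,
            Ideal.Quotient.eq_zero_iff_mem]
          exact q.1.mul_mem_right b hsq
        rw [← e.mk₀_id_comp, ← Ext.smul_comp, ← Ext.mk₀_smul, hz, Ext.mk₀_zero, Ext.zero_comp]
    | exact N₁ N₂ N₃ f g hf hg hfg h₁ h₃ =>
      intro e
      let S := ModuleCat.shortComplexOfCompEqZero f g hfg.linearMap_comp_eq_zero
      have hS : S.ShortExact := ModuleCat.shortComplex_shortExact S hfg hf hg
      obtain ⟨s, hs, hse⟩ := h₁ ((Ext.mk₀ S.f).comp e (zero_add j))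
      rw [← Ext.comp_smul] at hse
      obtain ⟨y, hy⟩ := Ext.contravariant_sequence_exact₂ hS (ModuleCat.of A A) (s • e) hse
      obtain ⟨t, ht, hty⟩ := h₃ y
      refine ⟨t * s, fun h => (hpp.mem_or_mem h).elim ht hs, ?_⟩
      rw [mul_smul, ← hy, ← Ext.comp_smul, hty, Ext.comp_zero]

theorem exists_dual_ne_zero {n : ℕ} [HasInjectiveDimensionLT (ModuleCat.of A A) n]
    (M : Type u) [AddCommGroup M] [Module A M] [Module.Finite A M]
    (hM : ∀ p : Ideal A, IsAssociatedPrime p M → p ∈ minimalPrimes A) (m : M) (hm : m ≠ 0) :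
    ∃ φ : M →ₗ[A] A, φ m ≠ 0 := by
  have : Nontrivial (Submodule.span A {m}) := (Submodule.nontrivial_span_singleton hm)
  obtain ⟨p, hp⟩ := associatedPrimes.nonempty A (Submodule.span A {m})
  have hpM : IsAssociatedPrime p M := hp.map_of_injective (Submodule.subtype _)
    (Submodule.injective_subtype _)
  have hpmin := hM p hpM
  obtain ⟨hpp, x, hx⟩ := isAssociatedPrime_iff.mp hp
  have hx' : ∀ a, a ∈ p ↔ a • (x : M) = 0 := by
    intro a
    rw [hx, Submodule.mem_colon_singleton, Submodule.mem_bot, Subtype.ext_iff]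
    rfl
  have hass : p ∈ associatedPrimes A A :=
    Module.associatedPrimes.minimalPrimes_annihilator_subset_associatedPrimes A A (by
      have : Module.annihilator A A = ⊥ := Module.annihilator_eq_bot.2 inferInstance
      rw [this]; exact hpmin)
  obtain ⟨-, a, ha⟩ := isAssociatedPrime_iff.mp (AssociatedPrimes.mem_iff.mp hass)
  have ha' : ∀ b, b ∈ p ↔ b * a = 0 := by
    intro b
    rw [ha, Submodule.mem_colon_singleton, Submodule.mem_bot, smul_eq_mul]
  let g : (A ⧸ p) →ₗ[A] A := Submodule.liftQ p (LinearMap.toSpanSingleton A A a)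
    (fun b hb => by simpa using (ha' b).1 hb)
  let f : (A ⧸ p) →ₗ[A] M := Submodule.liftQ p (LinearMap.toSpanSingleton A M x)
    (fun b hb => by simpa using (hx' b).1 hb)
  have hf : Function.Injective f := by
    rw [← LinearMap.ker_eq_bot]
    apply Submodule.ker_liftQ_eq_bot
    intro b hb
    rw [hx']
    simpa using hb
  let S := ModuleCat.shortComplexOfCompEqZero f (LinearMap.range f).mkQ
    f.exact_map_mkQ_range.linearMap_comp_eq_zero
  have hS : S.ShortExact := ModuleCat.shortComplex_shortExact S
    f.exact_map_mkQ_range hf (Submodule.mkQ_surjective _)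
  let e : Ext S.X₁ (ModuleCat.of A A) 0 := Ext.mk₀ (ModuleCat.ofHom g)
  obtain ⟨s, hs, hse⟩ := ext_torsion_of_minimalPrime (n := n) p hpmin n 1 le_rfl (by omega)
    (M ⧸ LinearMap.range f) (hS.extClass.comp e (add_zero 1))
  rw [← Ext.comp_smul] at hse
  obtain ⟨y, hy⟩ := Ext.contravariant_sequence_exact₁ hS (ModuleCat.of A A) (s • e) (add_zero 1) hse
  obtain ⟨φ, rfl⟩ := Ext.addEquiv₀.symm.surjective y
  have key : S.f ≫ φ = s • ModuleCat.ofHom g := by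
    apply Ext.addEquiv₀.symm.injective
    simpa [e, Ext.mk₀_smul] using hy
  refine ⟨φ.hom, fun h0 => ?_⟩
  have h1 : φ.hom (x : M) = s * a := by
    have := congrArg (fun t => t.hom (Submodule.Quotient.mk 1 : A ⧸ p)) key
    have h2 : f (Submodule.Quotient.mk 1) = x :=
      (Submodule.liftQ_apply _ _ _).trans (one_smul A _)
    have h3 : g (Submodule.Quotient.mk 1) = a :=
      (Submodule.liftQ_apply _ _ _).trans (one_smul A _)
    change φ.hom (f (Submodule.Quotient.mk 1)) = s • g (Submodule.Quotient.mk 1) at this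
    rwa [h2, h3] at this
  obtain ⟨c, hc⟩ := Submodule.mem_span_singleton.1 x.2
  rw [← hc, map_smul, h0, smul_zero] at h1
  exact hs ((ha' s).2 h1.symm)

end

section
variable {A : Type u} [CommRing A] [IsGorensteinLocalRing A]

theorem IsMCM.mem_minimalPrimes {M : ModuleCat.{u} A} (hM : IsMCM M) (p : Ideal A)
    (hp : IsAssociatedPrime p M) : p ∈ minimalPrimes A := by
  obtain ⟨_, rs, hrs, hl, hreg⟩ := hM
  obtain ⟨c, hc, hcl⟩ := exists_chain_of_isWeaklyRegular rs M hrs hreg ⟨p, hp.isPrime⟩ hp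
  refine ⟨⟨hp.isPrime, bot_le⟩, ?_⟩
  rintro q ⟨hq, -⟩ hqp
  by_contra hpq
  have hlt : (⟨q, hq⟩ : PrimeSpectrum A) < c.head := by
    rw [hc]
    exact lt_of_le_not_ge hqp hpq
  have h := Order.LTSeries.length_le_krullDim (c.cons ⟨q, hq⟩ hlt)
  change _ ≤ ringKrullDim A at h
  rw [← hl, ← hcl, RelSeries.cons_length] at h
  exact absurd (by exact_mod_cast h) (Nat.not_succ_le_self c.length)

/-- The minimal number of generators of the dual module `M^* = Hom(M, A)`. -/
noncomputable def dualRank (M : ModuleCat.{u} A) : ℕ :=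
  (⊤ : Submodule A (Module.Dual A M)).spanFinrank

theorem exists_dualGen {M : ModuleCat.{u} A} (hM : IsMCM M) :
    ∃ φ : Fin (dualRank M) → Module.Dual A M, Submodule.span A (Set.range φ) = ⊤ := by
  have := hM.1
  have : IsNoetherian A (M →ₗ[A] A) := isNoetherian_linearMap A A M
  obtain ⟨s, hs, hs'⟩ := Submodule.FG.exists_span_finset_card_eq_spanFinrank
    (IsNoetherian.noetherian (⊤ : Submodule A (Module.Dual A M)))
  change s.card = dualRank M at hs
  refine ⟨fun i => (s.equivFin.symm (Fin.cast hs.symm i) : Module.Dual A M), ?_⟩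
  refine Eq.trans (congrArg _ ?_) hs'
  ext x
  constructor
  · rintro ⟨i, rfl⟩
    exact (s.equivFin.symm (Fin.cast hs.symm i)).2
  · intro hx
    exact ⟨Fin.cast hs (s.equivFin ⟨x, hx⟩), by simp⟩

/-- A minimal system of generators `φ_1, …, φ_μ` of `M^*`, that is, a minimal free cover
`A^μ → M^*`. -/
noncomputable def dualGen (M : StableCM A) : Fin (dualRank M.obj) → Module.Dual A M.obj :=
  (exists_dualGen M.isMCM).choose

theorem span_dualGen (M : StableCM A) : Submodule.span A (Set.range (dualGen M)) = ⊤ :=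
  (exists_dualGen M.isMCM).choose_spec

/-- The map `M → A^μ`, `m ↦ (φ_1 m, …, φ_μ m)`: it is the dual of the minimal free cover
`A^μ → M^*`, composed with the biduality map `M → M^**`. -/
noncomputable def cosyzygyMap (M : StableCM A) : M.obj →ₗ[A] (Fin (dualRank M.obj) → A) :=
  LinearMap.pi (dualGen M)

/-- The co-syzygy `Ω⁻¹(M)`, the cokernel of `M → A^μ`. -/
noncomputable def cosyzygy (M : StableCM A) : ModuleCat.{u} A :=
  ModuleCat.of A ((Fin (dualRank M.obj) → A) ⧸ LinearMap.range (cosyzygyMap M))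

/-- The sequence `M → A^μ → Ω⁻¹(M)`. -/
noncomputable def cosyzygySequence (M : StableCM A) : ShortComplex (ModuleCat.{u} A) :=
  ShortComplex.mk (X₁ := M.obj) (X₂ := ModuleCat.of A (Fin (dualRank M.obj) → A))
    (X₃ := cosyzygy M) (ModuleCat.ofHom (cosyzygyMap M))
    (ModuleCat.ofHom (LinearMap.range (cosyzygyMap M)).mkQ) (by
      ext1
      exact (cosyzygyMap M).exact_map_mkQ_range.linearMap_comp_eq_zero)

theorem exists_comp_cosyzygyMap (M : StableCM A) (φ : Module.Dual A M.obj) :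
    ∃ ψ : (Fin (dualRank M.obj) → A) →ₗ[A] A, ψ ∘ₗ cosyzygyMap M = φ := by
  have h : φ ∈ Submodule.span A (Set.range (dualGen M)) := by
    rw [span_dualGen]; trivial
  obtain ⟨c, rfl⟩ := (Submodule.mem_span_range_iff_exists_fun A).1 h
  refine ⟨∑ i, c i • LinearMap.proj i, ?_⟩
  ext m
  simp [cosyzygyMap]

theorem cosyzygyMap_injective (M : StableCM A) : Function.Injective (cosyzygyMap M) := by
  obtain ⟨n, hn⟩ := IsGorensteinLocalRing.finite_injectiveDimension (A := A)
  have hfin := M.isMCM.1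
  rw [injective_iff_map_eq_zero]
  intro m hm
  by_contra hm0
  obtain ⟨φ, hφ⟩ := exists_dual_ne_zero (n := n + 1) M.obj M.isMCM.mem_minimalPrimes m hm0
  obtain ⟨ψ, rfl⟩ := exists_comp_cosyzygyMap M φ
  exact hφ (by simp [hm])

theorem cosyzygySequence_shortExact (M : StableCM A) : (cosyzygySequence M).ShortExact :=
  ModuleCat.shortComplex_shortExact _ (cosyzygyMap M).exact_map_mkQ_range
    (cosyzygyMap_injective M) (Submodule.mkQ_surjective _)

theorem exists_cosyzygy_factor (M N : StableCM A) (f : M.obj ⟶ N.obj)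
    (hf : f ∈ projectiveMaps M.obj N.obj) : ∃ h, f = (cosyzygySequence M).f ≫ h := by
  obtain ⟨P, hP, g, h, rfl⟩ := hf
  have := N.isMCM.1
  obtain ⟨k, π, hπ⟩ := Module.Finite.exists_fin' A N.obj
  have : Epi (ModuleCat.ofHom π) := (ModuleCat.epi_iff_surjective _).2 hπ
  let l : P ⟶ ModuleCat.of A (Fin k → A) := Projective.factorThru h (ModuleCat.ofHom π)
  have hl : l ≫ ModuleCat.ofHom π = h := Projective.factorThru_comp _ _
  choose ψ hψ using fun i : Fin k =>
    exists_comp_cosyzygyMap M (LinearMap.proj i ∘ₗ (g ≫ l).hom)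
  have hψ' : LinearMap.pi ψ ∘ₗ cosyzygyMap M = (g ≫ l).hom := by
    ext m i
    exact congrArg (fun t => t m) (hψ i)
  refine ⟨ModuleCat.ofHom (π ∘ₗ LinearMap.pi ψ), ?_⟩
  rw [← hl, ← Category.assoc]
  ext m
  exact congrArg π (congrArg (fun t => t m) hψ').symm

/-- The natural map `Hom(M, N) → Ext^1(Ω⁻¹(M), N)` that sends `f` to the class `α_f` of the
pushout of `0 → M → A^μ → Ω⁻¹(M) → 0` along `f`; on classes the pushout along `f` is the product
with `f`. -/
noncomputable def pushoutClass (M N : StableCM A) : (M.obj ⟶ N.obj) →ₗ[A] Ext (cosyzygy M) N.obj 1 :=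
  Ext.precompOfLinear (cosyzygySequence_shortExact M).extClass A N.obj (add_zero 1) ∘ₗ
    (Ext.linearEquiv₀ (R := A)).symm.toLinearMap

theorem pushoutClass_apply (M N : StableCM A) (f : M.obj ⟶ N.obj) :
    pushoutClass M N f =
      (cosyzygySequence_shortExact M).extClass.comp (Ext.mk₀ f) (add_zero 1) := rfl

theorem ker_pushoutClass (M N : StableCM A) :
    LinearMap.ker (pushoutClass M N) = projectiveMaps M.obj N.obj := by
  ext f
  rw [LinearMap.mem_ker, pushoutClass_apply]
  constructor
  · intro hf
    obtain ⟨y, hy⟩ := Ext.contravariant_sequence_exact₁ (cosyzygySequence_shortExact M) N.obj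
      (Ext.mk₀ f) (add_zero 1) hf
    obtain ⟨h, rfl⟩ := Ext.addEquiv₀.symm.surjective y
    refine ⟨(cosyzygySequence M).X₂, ?_, (cosyzygySequence M).f, h, ?_⟩
    · show Projective (ModuleCat.of A (Fin (dualRank M.obj) → A))
      infer_instance
    · apply Ext.addEquiv₀.symm.injective
      exact (Ext.mk₀_comp_mk₀ _ _).symm.trans hy
  · intro hf
    obtain ⟨h, rfl⟩ := exists_cosyzygy_factor M N f hf
    have := (cosyzygySequence_shortExact M).extClass_comp_assoc (Ext.mk₀ h) (h := add_zero 1)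
    rwa [Ext.mk₀_comp_mk₀] at this

theorem pushoutClass_surjective (M N : StableCM A) : Function.Surjective (pushoutClass M N) := by
  intro α
  have : Projective (cosyzygySequence M).X₂ := by
    show Projective (ModuleCat.of A (Fin (dualRank M.obj) → A))
    infer_instance
  obtain ⟨y, hy⟩ := Ext.contravariant_sequence_exact₃ (cosyzygySequence_shortExact M) N.obj
    α (Ext.eq_zero_of_projective _) (add_zero 1)
  obtain ⟨f, rfl⟩ := Ext.addEquiv₀.symm.surjective y
  exact ⟨f, hy⟩

/-- The natural isomorphism `η` from the stable Hom of `M` and `N` to `Ext^1(Ω⁻¹(M), N)`, induced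
by `f ↦ α_f`. -/
noncomputable def eta (M N : StableCM A) : (M ⟶ N) ≃ₗ[A] Ext (cosyzygy M) N.obj 1 :=
  (Submodule.quotEquivOfEq _ _ (ker_pushoutClass M N).symm).trans
    ((pushoutClass M N).quotKerEquivOfSurjective (pushoutClass_surjective M N))

theorem eta_mk (M N : StableCM A) (f : M.obj ⟶ N.obj) :
    eta M N (Submodule.Quotient.mk f : StableHom M.obj N.obj) = pushoutClass M N f := rfl

/-- `R(M, N)`, the preimage under `η` of the set of `T`-split classes. -/
def tSplitRelation (A : Type u) [CommRing A] [IsGorensteinLocalRing A] (M N : StableCM A) :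
    Set (M ⟶ N) :=
  eta M N ⁻¹' tSplitClasses (cosyzygy M) N.obj

end

/-!
# `T`-split extensions define an ideal of the stable category

Everything rests on two properties of `e^T`, valid for all finitely generated modules over a
Noetherian local ring of dimension `d ≥ 1`: it is subadditive along short exact sequences
(`eT_le_add`), since `Tor₁(-, A / 𝔪ⁿ)` is exact in the middle, and superadditive on direct sums
(`eT_add_le`).  Hence an extension `0 → N → E → M → 0` is `T`-split as soon as
`e^T(M) + e^T(N) ≤ e^T(E)`.  If `E₁` is the pushout of `E` along `N → N₁`, the exact sequence
`0 → N → E ⊕ N₁ → E₁ → 0` gives `e^T(E) + e^T(N₁) ≤ e^T(N) + e^T(E₁)`, so `E₁` is `T`-split when `E`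
is (`IsTSplit.comp_mk₀`); pullbacks are dual (`IsTSplit.mk₀_comp`), and direct sums are clear.  Baer
sums are built from these three, so the `T`-split classes form a submodule (`IsTSplit.add`,
`IsTSplit.smul`, `isTSplit_zero`).  Under `η`, composition on the right is pushout of classes
(`eta_comp`), and composition on the left is pullback along the induced map of co-syzygies
(`exists_comp_eta`).

The limit defining `e^T(M)` exists because `n ↦ ℓ(Tor₁(M, A / 𝔪ⁿ))` is eventually a polynomial of
degree less than `d` (`isEventuallyPolynomial_torLength`).  For a presentation `0 → L → F → M → 0`
with `F` free, `Tor₁(M, A / 𝔪ⁿ)` is the kernel of `L / 𝔪ⁿ L → F / 𝔪ⁿ F` (`torLength_eq`), so its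
length is an alternating sum of Hilbert–Samuel functions.  By the Artin–Rees lemma the kernel lies
in `𝔪ⁿ⁻ᶜ L / 𝔪ⁿ L`, whose length is a difference of the Hilbert–Samuel function of `L`, a polynomial
of degree at most `d` (`isEventuallyPolynomial_hilbertSamuel`).  That last fact is the Hilbert–Serre
theorem, proved by induction on the number of generators for graded modules that satisfy the
ascending chain condition on graded submodules
(`isEventuallyPolynomial_length_of_wellFoundedGT`).
-/

/-! ### Eventually polynomial functions -/

/-- `f : ℕ → ℚ` agrees, for all large arguments, with a polynomial of degree less than `d`. -/
def IsEventuallyPolynomial (d : ℕ) (f : ℕ → ℚ) : Prop :=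
  ∃ p ∈ Polynomial.degreeLT ℚ d, ∀ᶠ n : ℕ in atTop, f n = p.eval (n : ℚ)

namespace IsEventuallyPolynomial
open Polynomial

variable {d : ℕ} {f g : ℕ → ℚ}

theorem congr' (hf : IsEventuallyPolynomial d f) (h : ∀ᶠ n in atTop, g n = f n) :
    IsEventuallyPolynomial d g := by
  obtain ⟨p, hp, hfp⟩ := hf
  exact ⟨p, hp, by filter_upwards [hfp, h] with n h1 h2; rw [h2, h1]⟩

theorem add (hf : IsEventuallyPolynomial d f) (hg : IsEventuallyPolynomial d g) :
    IsEventuallyPolynomial d (fun n => f n + g n) := by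
  obtain ⟨p, hp, hfp⟩ := hf
  obtain ⟨q, hq, hgq⟩ := hg
  exact ⟨p + q, add_mem hp hq, by filter_upwards [hfp, hgq] with n h1 h2; simp [h1, h2]⟩

theorem sub (hf : IsEventuallyPolynomial d f) (hg : IsEventuallyPolynomial d g) :
    IsEventuallyPolynomial d (fun n => f n - g n) := by
  obtain ⟨p, hp, hfp⟩ := hf
  obtain ⟨q, hq, hgq⟩ := hg
  exact ⟨p - q, sub_mem hp hq, by filter_upwards [hfp, hgq] with n h1 h2; simp [h1, h2]⟩

theorem mem_degreeLT_comp_X_add_C {p : ℚ[X]} (hp : p ∈ degreeLT ℚ d) (c : ℚ) :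
    p.comp (X + C c) ∈ degreeLT ℚ d := by
  rw [mem_degreeLT] at hp ⊢
  rcases eq_or_ne p 0 with rfl | h0
  · simp
  · refine lt_of_le_of_lt ?_ hp
    rw [degree_eq_natDegree h0]
    refine degree_le_of_natDegree_le ?_
    rw [natDegree_comp, natDegree_X_add_C, mul_one]

theorem comp_add (hf : IsEventuallyPolynomial d f) (c : ℕ) :
    IsEventuallyPolynomial d (fun n => f (n + c)) := by
  obtain ⟨p, hp, hfp⟩ := hf
  refine ⟨p.comp (X + C (c : ℚ)), mem_degreeLT_comp_X_add_C hp _, ?_⟩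
  filter_upwards [(tendsto_add_atTop_nat c).eventually hfp] with n hn
  simp [hn]

/-- A backward difference lowers the degree.  The truncated subtraction is harmless, since only
large arguments matter. -/
theorem sub_shift (hf : IsEventuallyPolynomial (d + 1) f) (c : ℕ) :
    IsEventuallyPolynomial d (fun n => f n - f (n - c)) := by
  obtain ⟨p, hp, hfp⟩ := hf
  refine ⟨p - p.comp (X + C (-c : ℚ)), ?_, ?_⟩
  · rw [mem_degreeLT] at hp ⊢
    rcases eq_or_ne p 0 with rfl | h0
    · simp
    · have hdeg : p.natDegree = (p.comp (X + C (-c : ℚ))).natDegree := by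
        rw [natDegree_comp, natDegree_X_add_C, mul_one]
      have h0' : p.comp (X + C (-c : ℚ)) ≠ 0 := by
        rw [Ne, comp_eq_zero_iff]
        rintro (h | ⟨-, h⟩)
        · exact h0 h
        · have := congrArg natDegree h
          rw [natDegree_X_add_C] at this
          simp at this
      refine lt_of_lt_of_le (degree_sub_lt_left ?_ h0 ?_) (Order.lt_succ_iff.1 ?_ : p.degree ≤ d)
      · rw [degree_eq_natDegree h0, degree_eq_natDegree h0', hdeg]
      · rw [leadingCoeff_comp (by rw [natDegree_X_add_C]; exact one_ne_zero), leadingCoeff_X_add_C,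
          one_pow, mul_one]
      · rw [degree_eq_natDegree h0] at hp ⊢
        have : p.natDegree < d + 1 := by exact_mod_cast hp
        rw [Order.lt_succ_iff]
        exact_mod_cast Nat.lt_succ_iff.1 this
  · have hc : ∀ᶠ n : ℕ in atTop, f (n - c) = p.eval (((n - c : ℕ)) : ℚ) :=
      (tendsto_sub_atTop_nat c).eventually hfp
    filter_upwards [hfp, hc, eventually_ge_atTop c] with n h1 h2 h3
    simp [h1, h2, Nat.cast_sub h3, sub_eq_add_neg]

/-- Every polynomial is the forward difference of a polynomial, by the difference equation of the
Bernoulli polynomials. -/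
theorem exists_forwardDiff_eq {p : ℚ[X]} (hp : p ∈ degreeLT ℚ d) :
    ∃ q ∈ degreeLT ℚ (d + 1), ∀ x : ℚ, q.eval (x + 1) - q.eval x = p.eval x := by
  refine ⟨∑ i ∈ Finset.range d, C (p.coeff i / (i + 1)) * Polynomial.bernoulli (i + 1), ?_, ?_⟩
  · refine Submodule.sum_mem _ fun i hi => ?_
    rw [← smul_eq_C_mul]
    refine Submodule.smul_mem _ _ ?_
    rw [Polynomial.bernoulli]
    refine Submodule.sum_mem _ fun j hj => ?_
    rw [mem_degreeLT]
    refine lt_of_le_of_lt (degree_monomial_le _ _) ?_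
    rw [Finset.mem_range] at hi hj
    exact_mod_cast (by omega : i + 1 - j < d + 1)
  · intro x
    have hpd : p.natDegree < d ∨ p = 0 := by
      rcases eq_or_ne p 0 with rfl | h0
      · exact Or.inr rfl
      · rw [mem_degreeLT, degree_eq_natDegree h0] at hp
        exact Or.inl (by exact_mod_cast hp)
    have hpe : p.eval x = ∑ i ∈ Finset.range d, p.coeff i * x ^ i := by
      rcases hpd with h | rfl
      · exact eval_eq_sum_range' h x
      · simp
    rw [hpe, eval_finsetSum, eval_finsetSum, ← Finset.sum_sub_distrib]
    refine Finset.sum_congr rfl fun i _ => ?_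
    rw [eval_mul, eval_mul, eval_C, add_comm x 1, bernoulli_eval_one_add]
    have : (i : ℚ) + 1 ≠ 0 := by positivity
    have h1 : p.coeff i / (i + 1) * ((i : ℚ) + 1) = p.coeff i := div_mul_cancel₀ _ this
    push_cast
    rw [eval_C]
    linear_combination x ^ i * h1

/-- Summation raises the degree by at most one. -/
theorem of_forwardDiff (h : IsEventuallyPolynomial d (fun n => f (n + 1) - f n)) :
    IsEventuallyPolynomial (d + 1) f := by
  obtain ⟨p, hp, hfp⟩ := h
  obtain ⟨q, hq, hqp⟩ := exists_forwardDiff_eq hp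
  obtain ⟨n₀, hn₀⟩ := eventually_atTop.1 hfp
  refine ⟨q + C (f n₀ - q.eval (n₀ : ℚ)), add_mem hq ?_, ?_⟩
  · rw [mem_degreeLT]
    refine lt_of_le_of_lt degree_C_le ?_
    exact_mod_cast Nat.succ_pos d
  · refine eventually_atTop.2 ⟨n₀, fun n hn => ?_⟩
    induction n, hn using Nat.le_induction with
    | base => simp
    | succ n hn ih =>
      have h1 := hn₀ n hn
      have h2 := hqp n
      simp only [eval_add, eval_C] at ih ⊢
      push_cast
      linarith

/-- An upper bound of degree less than `d` for a nonnegative function improves the degree bound. -/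
theorem of_le {D : ℕ} (hf : IsEventuallyPolynomial D f) (hg : IsEventuallyPolynomial d g)
    (h0 : ∀ n, 0 ≤ f n) (hfg : ∀ᶠ n in atTop, f n ≤ g n) : IsEventuallyPolynomial d f := by
  obtain ⟨p, -, hp⟩ := hf
  obtain ⟨q, hq, hgq⟩ := hg
  refine ⟨p, mem_degreeLT.2 ?_, hp⟩
  by_contra! hlt
  have hP0 : p ≠ 0 := by
    rintro rfl
    rw [degree_zero] at hlt
    exact absurd (le_bot_iff.1 hlt) (by simp)
  have hr := (tendsto_natCast_atTop_atTop (R := ℚ)).eventually (eventually_atTop_not_isRoot p hP0)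
  have ht := (div_tendsto_atTop_zero_of_degree_lt q p ((mem_degreeLT.1 hq).trans_le hlt)).comp
    (tendsto_natCast_atTop_atTop (R := ℚ))
  have hge : ∀ᶠ n : ℕ in atTop, (1 : ℚ) ≤ q.eval (n : ℚ) / p.eval (n : ℚ) := by
    filter_upwards [hp, hgq, hfg, hr] with n h1 h2 h4 h5
    have h3 := h0 n
    rw [h1] at h3 h4
    rw [h2] at h4
    rwa [one_le_div (lt_of_le_of_ne h3 (Ne.symm h5))]
  exact absurd (ge_of_tendsto ht hge) (by norm_num)

theorem tendsto_div_pow (hf : IsEventuallyPolynomial (d + 1) f) :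
    ∃ l : ℝ, Tendsto (fun n : ℕ => (f n : ℝ) / (n : ℝ) ^ d) atTop (𝓝 l) := by
  obtain ⟨p, hpd, hp⟩ := hf
  let P : ℝ[X] := p.map (algebraMap ℚ ℝ)
  have hPe : ∀ n : ℕ, P.eval (n : ℝ) = ((p.eval (n : ℚ) : ℚ) : ℝ) :=
    fun n => eval_natCast_map (algebraMap ℚ ℝ) p n
  have hPd : P.degree ≤ d := by
    rw [degree_le_iff_coeff_zero]
    intro m hm
    rw [coeff_map, mem_degreeLT.1 hpd |> (degree_lt_iff_coeff_zero _ _).1 <| m, map_zero]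
    exact_mod_cast hm
  have hX : ∀ n : ℕ, (n : ℝ) ^ d = (X ^ d : ℝ[X]).eval (n : ℝ) := fun n => by simp
  have hXd : (X ^ d : ℝ[X]).degree = d := degree_X_pow d
  have hev : ∀ᶠ n : ℕ in atTop, P.eval (n : ℝ) / (X ^ d : ℝ[X]).eval (n : ℝ) =
      (f n : ℝ) / (n : ℝ) ^ d := by
    filter_upwards [hp] with n hn
    rw [hX, hn, hPe]
  rcases hPd.lt_or_eq with h | h
  · exact ⟨_, ((div_tendsto_atTop_zero_of_degree_lt P (X ^ d) (by rwa [hXd])).comp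
      (tendsto_natCast_atTop_atTop (R := ℝ))).congr' hev⟩
  · exact ⟨_, ((div_tendsto_atTop_leadingCoeff_div_of_degree_eq P (X ^ d) (by rw [hXd, h])).comp
      (tendsto_natCast_atTop_atTop (R := ℝ))).congr' hev⟩

end IsEventuallyPolynomial

/-! ### Hilbert functions of graded modules -/

section
variable {A : Type u} [CommRing A]

theorem toNat_length_eq_add_of_exact {N M P : Type u} [AddCommGroup N] [AddCommGroup M]
    [AddCommGroup P] [Module A N] [Module A M] [Module A P] (f : N →ₗ[A] M) (g : M →ₗ[A] P)
    (hf : Function.Injective f) (hg : Function.Surjective g) (H : Function.Exact f g)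
    (hM : IsFiniteLength A M) :
    (Module.length A M).toNat = (Module.length A N).toNat + (Module.length A P).toNat := by
  rw [Module.length_eq_add_of_exact f g hf hg H, ENat.toNat_add]
  · exact Module.length_ne_top_iff.2 (hM.of_injective hf)
  · exact Module.length_ne_top_iff.2 (hM.of_surjective hg)

/-- A family of submodules `L n ≤ N n` of a graded module that is stable under the degree one
operators `x i`; that is, a graded submodule. -/
abbrev StableFamily {r : ℕ} {N : ℕ → Type u} [∀ n, AddCommGroup (N n)] [∀ n, Module A (N n)]
    (x : Fin r → ∀ n, N n →ₗ[A] N (n + 1)) : Type u :=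
  {L : ∀ n, Submodule A (N n) // ∀ i n, ∀ v ∈ L n, x i n v ∈ L (n + 1)}

/-- The graded image of a degree one operator: the range of `y (n - 1)` in degree `n`, and zero in
degree `0`. -/
def degreeOneRange {N : ℕ → Type u} [∀ n, AddCommGroup (N n)] [∀ n, Module A (N n)]
    (y : ∀ n, N n →ₗ[A] N (n + 1)) : ∀ n, Submodule A (N n)
  | 0 => ⊥
  | n + 1 => LinearMap.range (y n)

/-- **Hilbert–Serre**: a graded module with `r` commuting operators of degree one, of finite length
in each degree and satisfying the ascending chain condition on graded submodules, has a Hilbert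
function that is eventually polynomial of degree less than `r`.  The chain condition stands in for
finite generation over `A[x₁, …, x_r]`, because it passes without effort to the kernel and the
cokernel of an operator, where that operator acts as zero and the others remain. -/
theorem isEventuallyPolynomial_length_of_wellFoundedGT (r : ℕ) :
    ∀ (N : ℕ → Type u) [∀ n, AddCommGroup (N n)] [∀ n, Module A (N n)]
      (x : Fin r → ∀ n, N n →ₗ[A] N (n + 1)),
      (∀ i j n v, x i (n + 1) (x j n v) = x j (n + 1) (x i n v)) →
      (∀ n, IsFiniteLength A (N n)) → WellFoundedGT (StableFamily x) →
      IsEventuallyPolynomial r (fun n => ((Module.length A (N n)).toNat : ℚ)) := by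
  induction r with
  | zero =>
    intro N _ _ x _ _ hacc
    -- With no operators any family is stable, so the truncations of `N` stabilize.
    let L : ℕ →o StableFamily x :=
      { toFun := fun k => ⟨fun n => if n < k then ⊤ else ⊥, fun i => i.elim0⟩
        monotone' := fun k l hkl n => by
          by_cases h : n < k
          · simp [h, h.trans_le hkl]
          · simp [h] }
    obtain ⟨k, hk⟩ := WellFoundedGT.monotone_chain_condition L
    refine ⟨0, zero_mem _, eventually_atTop.2 ⟨k, fun n hn => ?_⟩⟩
    have h1 := congrFun (congrArg Subtype.val (hk (n + 1) (by omega))) n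
    have h2 : (⊥ : Submodule A (N n)) = ⊤ := by
      change (if n < k then ⊤ else ⊥) = (if n < n + 1 then ⊤ else ⊥) at h1
      simpa [not_lt.2 hn] using h1
    have : Subsingleton (N n) := (Submodule.subsingleton_iff A).1 (subsingleton_of_bot_eq_top h2)
    simp [Module.length_eq_zero]
  | succ r ih =>
    intro N _ _ x hcomm hfin hacc
    -- The kernel and the cokernel of `x 0` carry the operators `x 1, …, x r`.
    have hK : ∀ (i : Fin r) n, ∀ v ∈ LinearMap.ker (x 0 n),
        x i.succ n v ∈ LinearMap.ker (x 0 (n + 1)) := fun i n v hv => by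
      rw [LinearMap.mem_ker] at hv ⊢
      rw [hcomm, hv, map_zero]
    have hB : ∀ (i : Fin r) n, degreeOneRange (x 0) n ≤
        (degreeOneRange (x 0) (n + 1)).comap (x i.succ n) := fun i n v hv => by
      cases n with
      | zero =>
        rw [(Submodule.mem_bot A).1 hv]
        exact zero_mem _
      | succ n =>
        obtain ⟨w, rfl⟩ := hv
        exact ⟨x i.succ n w, hcomm _ _ _ _⟩
    have h1 := ih (fun n => LinearMap.ker (x 0 n))
      (fun i n => (x i.succ n).restrict (hK i n))
      (fun i j n v => Subtype.ext (hcomm _ _ _ _))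
      (fun n => (hfin n).of_injective (Submodule.subtype_injective _)) (by
        let F : StableFamily (fun (i : Fin r) n => (x i.succ n).restrict (hK i n)) →
            StableFamily x := fun L => ⟨fun n => (L.1 n).map (Submodule.subtype _), by
          rintro i n _ ⟨v, hv, rfl⟩
          refine Fin.cases ?_ (fun i => ?_) i
          · have : x 0 n (Submodule.subtype _ v) = 0 := v.2
            rw [this]
            exact zero_mem _
          · exact ⟨_, L.2 i n v hv, rfl⟩⟩
        have hF : StrictMono F := by
          refine Monotone.strictMono_of_injective (fun L L' h n => Submodule.map_mono (h n)) ?_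
          intro L L' h
          ext1
          funext n
          exact Submodule.map_injective_of_injective (Submodule.subtype_injective _)
            (congrFun (congrArg Subtype.val h) n)
        exact hF.wellFoundedGT)
    have h2 := ih (fun n => N n ⧸ degreeOneRange (x 0) n)
      (fun i n => Submodule.mapQ _ _ (x i.succ n) (hB i n))
      (fun i j n v => by
        obtain ⟨v, rfl⟩ := Submodule.Quotient.mk_surjective _ v
        exact congrArg (Submodule.Quotient.mk) (hcomm _ _ _ _))
      (fun n => (hfin n).of_surjective (Submodule.mkQ_surjective _)) (by
        let F : StableFamily (fun (i : Fin r) n => Submodule.mapQ _ _ (x i.succ n) (hB i n)) →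
            StableFamily x := fun L => ⟨fun n => (L.1 n).comap (Submodule.mkQ _), by
          intro i n v hv
          refine Fin.cases ?_ (fun i => ?_) i
          · have h0 : (degreeOneRange (x 0) (n + 1)).mkQ (x 0 n v) = 0 :=
              (Submodule.Quotient.mk_eq_zero _).2 ⟨v, rfl⟩
            rw [Submodule.mem_comap, h0]
            exact zero_mem _
          · exact L.2 i n _ hv⟩
        have hF : StrictMono F := by
          refine Monotone.strictMono_of_injective (fun L L' h n => Submodule.comap_mono (h n)) ?_
          intro L L' h
          ext1
          funext n
          exact Submodule.comap_injective_of_surjective (Submodule.mkQ_surjective _)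
            (congrFun (congrArg Subtype.val h) n)
        exact hF.wellFoundedGT)
    refine IsEventuallyPolynomial.of_forwardDiff (((h2.comp_add 1).sub h1).congr'
      (Eventually.of_forall fun n => ?_))
    have e1 := toNat_length_eq_add_of_exact (LinearMap.ker (x 0 n)).subtype (x 0 n).rangeRestrict
      (Submodule.subtype_injective _) (x 0 n).surjective_rangeRestrict
      (by
        rw [LinearMap.exact_iff, LinearMap.ker_rangeRestrict, Submodule.range_subtype]) (hfin n)
    have e2 := toNat_length_eq_add_of_exact (LinearMap.range (x 0 n)).subtype
      (LinearMap.range (x 0 n)).mkQ (Submodule.subtype_injective _) (Submodule.mkQ_surjective _)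
      (by rw [LinearMap.exact_iff, Submodule.ker_mkQ, Submodule.range_subtype]) (hfin (n + 1))
    change _ = (((Module.length A (N (n + 1) ⧸ LinearMap.range (x 0 n))).toNat : ℕ) : ℚ) - _
    rw [e2, e1]
    push_cast
    ring

end

/-! ### The Hilbert–Samuel function of an ideal -/

section
variable {A : Type u} [CommRing A] (I : Ideal A)
  (M : Type u) [AddCommGroup M] [Module A M]

/-- The graded piece `I ^ n M / I ^ (n + 1) M`, as a submodule of `M / I ^ (n + 1) M`. -/
abbrev gradedPiece (n : ℕ) : Submodule A (M ⧸ (I ^ (n + 1) • ⊤ : Submodule A M)) :=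
  (I ^ n • ⊤ : Submodule A M).map (I ^ (n + 1) • ⊤ : Submodule A M).mkQ

variable {I M}

theorem smul_mem_pow_succ_smul_top {a : A} (ha : a ∈ I) {n : ℕ} {m : M}
    (hm : m ∈ (I ^ n • ⊤ : Submodule A M)) : a • m ∈ (I ^ (n + 1) • ⊤ : Submodule A M) := by
  rw [pow_succ', mul_smul]
  exact Submodule.smul_mem_smul ha hm

/-- Multiplication by `a ∈ I`, as an operator of degree one on the associated graded module. -/
def gradedMul {a : A} (ha : a ∈ I) (n : ℕ) : gradedPiece I M n →ₗ[A] gradedPiece I M (n + 1) :=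
  (Submodule.mapQ _ _ (LinearMap.lsmul A M a)
    (fun _ hm => smul_mem_pow_succ_smul_top ha hm)).restrict (by
      rintro _ ⟨m, hm, rfl⟩
      exact ⟨a • m, smul_mem_pow_succ_smul_top ha hm, rfl⟩)

/-- The `I`-filtration of `M` whose graded pieces are the members of a stable family. -/
def filtrationOfStableFamily {r : ℕ} {a : Fin r → A} (ha : ∀ i, a i ∈ I)
    (hI : I = Ideal.span (Set.range a))
    (L : StableFamily (fun i n => gradedMul (M := M) (ha i) n)) : I.Filtration M where
  N n := ((L.1 n).map (gradedPiece I M n).subtype).comap (I ^ (n + 1) • ⊤ : Submodule A M).mkQ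
  mono n := by
    rintro m ⟨⟨_, ⟨m', hm', rfl⟩⟩, -, h⟩
    have h1 : m' - m ∈ (I ^ (n + 2) • ⊤ : Submodule A M) := (Submodule.Quotient.eq _).1 h
    have h2 : m ∈ (I ^ (n + 1) • ⊤ : Submodule A M) := by
      have := sub_mem hm' (Submodule.smul_mono_left (Ideal.pow_le_pow_right (Nat.le_succ _)) h1)
      rwa [sub_sub_cancel] at this
    have h3 : (I ^ (n + 1) • ⊤ : Submodule A M).mkQ m = 0 :=
      (Submodule.Quotient.mk_eq_zero _).2 h2
    rw [Submodule.mem_comap, h3]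
    exact zero_mem _
  smul_le n := by
    rw [Submodule.smul_le]
    intro x hx m hm
    rw [hI] at hx
    induction hx using Submodule.span_induction with
    | mem x hx =>
      obtain ⟨i, rfl⟩ := hx
      obtain ⟨v, hv, h⟩ := hm
      refine ⟨_, L.2 i n v hv, ?_⟩
      have := congrArg (Submodule.mapQ _ (I ^ (n + 2) • ⊤ : Submodule A M)
        (LinearMap.lsmul A M (a i)) (fun _ hm => smul_mem_pow_succ_smul_top (ha i) hm)) h
      exact this
    | zero => rw [zero_smul]; exact zero_mem _
    | add x y _ _ hx hy => rw [add_smul]; exact add_mem hx hy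
    | smul b x _ hx => rw [smul_assoc]; exact Submodule.smul_mem _ _ hx

theorem filtrationOfStableFamily_le {r : ℕ} {a : Fin r → A} (ha : ∀ i, a i ∈ I)
    (hI : I = Ideal.span (Set.range a))
    (L : StableFamily (fun i n => gradedMul (M := M) (ha i) n)) (n : ℕ) :
    (filtrationOfStableFamily ha hI L).N n ≤ I ^ n • ⊤ := by
  rintro m ⟨⟨_, ⟨m', hm', rfl⟩⟩, -, h⟩
  have h1 : m' - m ∈ (I ^ (n + 1) • ⊤ : Submodule A M) := (Submodule.Quotient.eq _).1 h
  have := sub_mem hm' (Submodule.smul_mono_left (Ideal.pow_le_pow_right (Nat.le_succ _)) h1)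
  rwa [sub_sub_cancel] at this

/-- The filtration determines the family. -/
theorem filtrationOfStableFamily_le_iff {r : ℕ} {a : Fin r → A} (ha : ∀ i, a i ∈ I)
    (hI : I = Ideal.span (Set.range a))
    (L L' : StableFamily (fun i n => gradedMul (M := M) (ha i) n)) :
    (∀ n, (filtrationOfStableFamily ha hI L).N n ≤ (filtrationOfStableFamily ha hI L').N n) ↔
      L ≤ L' := by
  refine forall_congr' fun n => ?_
  rw [← Submodule.map_le_map_iff_of_injective (Submodule.subtype_injective (gradedPiece I M n))]
  exact Submodule.comap_le_comap_iff_of_surjective (Submodule.mkQ_surjective _)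

/-- The associated graded module satisfies the ascending chain condition on graded submodules:
through the corresponding filtrations these embed into the submodules of the Rees module `⊕ Iⁿ M`,
which is Noetherian over the Rees algebra. -/
theorem wellFoundedGT_stableFamily_gradedMul [IsNoetherianRing A] [Module.Finite A M] {r : ℕ}
    {a : Fin r → A} (ha : ∀ i, a i ∈ I) (hI : I = Ideal.span (Set.range a)) :
    WellFoundedGT (StableFamily (fun i n => gradedMul (M := M) (ha i) n)) := by
  let S := (I.stableFiltration (⊤ : Submodule A M)).submodule
  have hS : S.FG := (Ideal.Filtration.submodule_fg_iff_stable _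
    (fun i => IsNoetherian.noetherian _)).2 (I.stableFiltration_stable ⊤)
  have : IsNoetherian (reesAlgebra I) S := isNoetherian_of_fg_of_noetherian _ hS
  let G : StableFamily (fun i n => gradedMul (M := M) (ha i) n) → Submodule (reesAlgebra I) S :=
    fun L => (filtrationOfStableFamily ha hI L).submodule.comap S.subtype
  have hG : ∀ L L', G L ≤ G L' ↔ L ≤ L' := by
    intro L L'
    rw [← filtrationOfStableFamily_le_iff ha hI]
    constructor
    · intro h n m hm
      have hmem : ∀ F : I.Filtration M, m ∈ F.N n ↔
          PolynomialModule.single A n m ∈ F.submodule := by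
        intro F
        rw [Ideal.Filtration.mem_submodule]
        constructor
        · intro hmF i
          rw [PolynomialModule.coeff_single, Finsupp.single_apply]
          split_ifs with hi
          · exact hi ▸ hmF
          · exact zero_mem _
        · intro hF
          simpa using hF n
      have hmS : PolynomialModule.single A n m ∈ S :=
        (hmem _).1 (filtrationOfStableFamily_le ha hI L n hm)
      exact (hmem _).2 (h (x := ⟨_, hmS⟩) ((hmem _).1 hm))
    · intro h f hf i
      exact h i (hf i)
  exact ((OrderEmbedding.ofMapLEIff G hG).strictMono).wellFoundedGT

/-- **Hilbert–Samuel**: the length of `M / I ^ n M` is eventually polynomial, of degree at most the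
number of generators of `I`. -/
theorem isEventuallyPolynomial_length_quotient_pow [IsNoetherianRing A] [Module.Finite A M] {r : ℕ}
    (a : Fin r → A) (hI : I = Ideal.span (Set.range a))
    (hfin : ∀ n, IsFiniteLength A (M ⧸ (I ^ n • ⊤ : Submodule A M))) :
    IsEventuallyPolynomial (r + 1)
      (fun n => ((Module.length A (M ⧸ (I ^ n • ⊤ : Submodule A M))).toNat : ℚ)) := by
  have ha : ∀ i, a i ∈ I := fun i => hI ▸ Ideal.subset_span (Set.mem_range_self i)
  refine IsEventuallyPolynomial.of_forwardDiff ((isEventuallyPolynomial_length_of_wellFoundedGT r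
    (fun n => gradedPiece I M n) (fun i n => gradedMul (ha i) n) ?_
    (fun n => (hfin (n + 1)).of_injective (Submodule.subtype_injective _))
    (wellFoundedGT_stableFamily_gradedMul ha hI)).congr' (Eventually.of_forall fun n => ?_))
  · rintro i j n ⟨_, ⟨m, hm, rfl⟩⟩
    exact Subtype.ext (congrArg Submodule.Quotient.mk (smul_comm (a i) (a j) m))
  · have hle : (I ^ (n + 1) • ⊤ : Submodule A M) ≤ I ^ n • ⊤ :=
      Submodule.smul_mono_left (Ideal.pow_le_pow_right (Nat.le_succ _))
    have := toNat_length_eq_add_of_exact (gradedPiece I M n).subtype (Submodule.factor hle)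
      (Submodule.subtype_injective _) (Submodule.factor_surjective hle) (by
        rw [LinearMap.exact_iff, Submodule.range_subtype]
        ext v
        obtain ⟨m, rfl⟩ := Submodule.Quotient.mk_surjective _ v
        rw [LinearMap.mem_ker]
        constructor
        · intro h
          exact ⟨m, (Submodule.Quotient.mk_eq_zero _).1 h, rfl⟩
        · rintro ⟨m', hm', h⟩
          rw [← h]
          exact (Submodule.Quotient.mk_eq_zero _).2 hm') (hfin (n + 1))
    change _ - _ = (((Module.length A (gradedPiece I M n)).toNat : ℕ) : ℚ)
    rw [this]
    push_cast
    ring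

end

/-! ### Local rings: degree at most the dimension -/

section
open IsLocalRing
variable {A : Type u} [CommRing A] [IsNoetherianRing A] [IsLocalRing A]

/-- A finitely generated module that is annihilated by a power of the maximal ideal has finite
length. -/
theorem isFiniteLength_of_maximalIdeal_pow_smul (k : ℕ)
    (X : Type u) [AddCommGroup X] [Module A X] [Module.Finite A X]
    (h : ∀ a ∈ maximalIdeal A ^ k, ∀ x : X, a • x = 0) : IsFiniteLength A X := by
  rcases Nat.eq_zero_or_pos k with rfl | hk
  · have : Subsingleton X := by
      refine ⟨fun x y => ?_⟩
      rw [← one_smul A x, ← one_smul A y, h 1 (by simp), h 1 (by simp)]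
    exact .of_subsingleton
  have : IsArtinianRing (A ⧸ maximalIdeal A ^ k) := by
    apply IsLocalRing.quotient_artinian_of_mem_minimalPrimes_of_isLocalRing
    rw [← Ideal.radical_minimalPrimes, Ideal.radical_pow _ hk.ne', Ideal.radical_minimalPrimes,
      Ideal.minimalPrimes_eq_subsingleton_self]
    exact Set.mem_singleton _
  have hI : Module.IsTorsionBySet A X (maximalIdeal A ^ k : Ideal A) := fun x a => h a a.2 x
  let : Module (A ⧸ maximalIdeal A ^ k) X := hI.module
  have : IsScalarTower A (A ⧸ maximalIdeal A ^ k) X := hI.isScalarTower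
  have : Module.Finite (A ⧸ maximalIdeal A ^ k) X := Module.Finite.of_restrictScalars_finite A _ X
  rw [isFiniteLength_iff_isNoetherian_isArtinian]
  exact ⟨inferInstance, isArtinian_of_surjective_algebraMap
    (S := A) (R := A ⧸ maximalIdeal A ^ k) Ideal.Quotient.mk_surjective⟩

theorem isFiniteLength_quotient_pow_smul_top {k : ℕ} {I : Ideal A} (hI : maximalIdeal A ^ k ≤ I)
    (M : Type u) [AddCommGroup M] [Module A M] [Module.Finite A M] (n : ℕ) :
    IsFiniteLength A (M ⧸ (I ^ n • ⊤ : Submodule A M)) := by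
  refine isFiniteLength_of_maximalIdeal_pow_smul (k * n) _ fun a ha x => ?_
  obtain ⟨x, rfl⟩ := Submodule.Quotient.mk_surjective _ x
  rw [pow_mul] at ha
  exact (Submodule.Quotient.mk_eq_zero _).2
    (Submodule.smul_mem_smul (Ideal.pow_right_mono hI n ha) trivial)

theorem dimNat_cast : (dimNat A : WithBot ℕ∞) = ringKrullDim A := by
  have h1 : ringKrullDim A ≠ ⊥ := ringKrullDim_ne_bot
  have h2 : ringKrullDim A ≠ ⊤ := ringKrullDim_ne_top
  revert h1 h2
  rw [dimNat]
  generalize ringKrullDim A = x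
  induction x with
  | bot => simp
  | coe x => 
    intro _ h
    have : x ≠ ⊤ := fun h' => h (by rw [h']; rfl)
    lift x to ℕ using this
    rfl

variable (A) in
/-- A system of parameters: `dim A` elements generating an `𝔪`-primary ideal. -/
theorem exists_systemOfParameters :
    ∃ (a : Fin (dimNat A) → A) (k : ℕ), maximalIdeal A ^ k ≤ Ideal.span (Set.range a) ∧
      Ideal.span (Set.range a) ≤ maximalIdeal A := by
  obtain ⟨s, hs, hcard⟩ := (maximalIdeal A).exists_finset_card_eq_height_of_isNoetherianRing
  have hc : s.card = dimNat A := by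
    have h1 : ((maximalIdeal A).height : WithBot ℕ∞) = dimNat A := by
      rw [maximalIdeal_height_eq_ringKrullDim, dimNat_cast]
    rw [← hcard] at h1
    exact_mod_cast h1
  have := quotient_artinian_of_mem_minimalPrimes_of_isLocalRing _ hs
  obtain ⟨k, hk⟩ := exists_maximalIdeal_pow_le_of_isArtinianRing_quotient (Ideal.span (s : Set A))
  have hr : Set.range (fun i => (s.equivFin.symm (Fin.cast hc.symm i) : A)) = s := by
    ext x
    constructor
    · rintro ⟨i, rfl⟩
      exact (s.equivFin.symm (Fin.cast hc.symm i)).2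
    · intro hx
      exact ⟨Fin.cast hc (s.equivFin ⟨x, hx⟩), by simp⟩
  refine ⟨fun i => (s.equivFin.symm (Fin.cast hc.symm i) : A), k, ?_, ?_⟩
  · rwa [hr]
  · rw [hr]
    exact hs.1.2

/-- The Hilbert–Samuel function of a finitely generated module is eventually polynomial, of degree
at most `dim A`: a minimal system of generators of `𝔪` gives polynomiality, and comparison with the
powers of a parameter ideal gives the degree. -/
theorem isEventuallyPolynomial_hilbertSamuel (M : Type u) [AddCommGroup M] [Module A M]
    [Module.Finite A M] :
    IsEventuallyPolynomial (dimNat A + 1) (fun n =>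
      ((Module.length A (M ⧸ (maximalIdeal A ^ n • ⊤ : Submodule A M))).toNat : ℚ)) := by
  obtain ⟨a, k, hk, hle⟩ := exists_systemOfParameters A
  obtain ⟨r, b, hb⟩ := Submodule.fg_iff_exists_fin_generating_family.1
    (IsNoetherian.noetherian (maximalIdeal A))
  refine (isEventuallyPolynomial_length_quotient_pow (M := M) b hb.symm
    (isFiniteLength_quotient_pow_smul_top (k := 1) (by rw [pow_one]) M)).of_le
    (isEventuallyPolynomial_length_quotient_pow (M := M) a rfl
      (isFiniteLength_quotient_pow_smul_top hk M)) (fun n => Nat.cast_nonneg _)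
    (Eventually.of_forall fun n => ?_)
  have h : (Ideal.span (Set.range a) ^ n • ⊤ : Submodule A M) ≤ maximalIdeal A ^ n • ⊤ :=
    Submodule.smul_mono_left (Ideal.pow_right_mono hle n)
  exact Nat.cast_le.2 (ENat.toNat_le_toNat
    (Module.length_le_of_surjective (Submodule.factor h) (Submodule.factor_surjective h))
    (Module.length_ne_top_iff.2 (isFiniteLength_quotient_pow_smul_top hk M n)))

end

/-! ### `Tor₁` as a kernel of tensor products -/

section
open TensorProduct
variable {A : Type u} [CommRing A]

/-- The homology at the middle of `X₁ → X₂ → X₃`, computed from a cokernel `φ : X₂ → Q` of the first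
map: it has the length of the kernel of the induced map `ψ : Q → X₃`. -/
theorem length_homology_eq (S : ShortComplex (ModuleCat.{u} A)) {Q : Type u} [AddCommGroup Q]
    [Module A Q] (φ : S.X₂ →ₗ[A] Q) (ψ : Q →ₗ[A] S.X₃) (hφ : Function.Surjective φ)
    (hex : Function.Exact S.f.hom φ) (hψ : ψ ∘ₗ φ = S.g.hom) :
    Module.length A S.homology = Module.length A (LinearMap.ker ψ) := by
  rw [S.moduleCatHomologyIso.toLinearEquiv.length_eq]
  have hmem : ∀ x, x ∈ LinearMap.ker S.g.hom ↔ φ x ∈ LinearMap.ker ψ := fun x => by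
    rw [← hψ]; rfl
  let φ' : LinearMap.ker S.g.hom →ₗ[A] LinearMap.ker ψ := φ.restrict fun x hx => (hmem x).1 hx
  have hφ' : Function.Surjective φ' := by
    rintro ⟨y, hy⟩
    obtain ⟨x, rfl⟩ := hφ y
    exact ⟨⟨x, (hmem x).2 hy⟩, rfl⟩
  have hker : LinearMap.range S.moduleCatToCycles = LinearMap.ker φ' := by
    ext x
    rw [LinearMap.mem_ker, ← Submodule.coe_eq_zero]
    constructor
    · rintro ⟨y, rfl⟩
      exact hex.apply_apply_eq_zero y
    · intro h
      obtain ⟨y, hy⟩ := (hex _).1 h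
      exact ⟨y, Subtype.ext hy⟩
  exact ((Submodule.quotEquivOfEq _ _ hker).trans (φ'.quotKerEquivOfSurjective hφ')).length_eq

theorem length_le_add_of_exact {N M P : Type u} [AddCommGroup N] [AddCommGroup M]
    [AddCommGroup P] [Module A N] [Module A M] [Module A P] (f : N →ₗ[A] M) (g : M →ₗ[A] P)
    (H : Function.Exact f g) :
    Module.length A M ≤ Module.length A N + Module.length A P := by
  rw [Module.length_eq_add_of_exact (LinearMap.ker g).subtype g.rangeRestrict
    (Submodule.subtype_injective _) g.surjective_rangeRestrict
    (by rw [LinearMap.exact_iff, LinearMap.ker_rangeRestrict, Submodule.range_subtype])]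
  refine add_le_add ?_ (Module.length_le_of_injective _ (Submodule.subtype_injective _))
  rw [LinearMap.exact_iff.1 H]
  exact Module.length_le_of_surjective _ f.surjective_rangeRestrict

/-- `Tor₁(M, B)` has the length of the kernel of `M ⊗ K → M ⊗ P`, where `P` is a flat module that
covers `B`, with kernel `K`, and does not depend on `M`. -/
theorem exists_length_tor_eq (B : ModuleCat.{u} A) :
    ∃ (P : ModuleCat.{u} A) (K : Submodule A P), Module.Flat A P ∧ Nonempty ((P ⧸ K) ≃ₗ[A] B) ∧
      ∀ M : ModuleCat.{u} A, Module.length A (((Tor (ModuleCat.{u} A) 1).obj M).obj B) =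
        Module.length A (LinearMap.ker (K.subtype.lTensor M)) := by
  let R := projectiveResolution B
  let b := (R.complex.d 1 0).hom
  let a := (R.complex.d 2 1).hom
  have hab : Function.Exact a b :=
    (ShortComplex.ShortExact.moduleCat_exact_iff_function_exact _).1 (R.exact_succ 0)
  have hb : Function.Exact b (R.π.f 0).hom :=
    (ShortComplex.ShortExact.moduleCat_exact_iff_function_exact _).1 R.exact₀
  have : Epi (R.π.f 0) := inferInstance
  have hc : Function.Surjective (R.π.f 0).hom := (ModuleCat.epi_iff_surjective _).1 this
  refine ⟨R.complex.X 0, LinearMap.range b, ?_, ?_, ?_⟩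
  · have h := R.projective 0
    have : Module.Projective A (R.complex.X 0) :=
      (IsProjective.iff_projective (R := A) (R.complex.X 0)).2 h
    infer_instance
  · exact ⟨(Submodule.quotEquivOfEq _ _ (LinearMap.exact_iff.1 hb).symm).trans
      ((R.π.f 0).hom.quotKerEquivOfSurjective hc)⟩
  · intro M
    let F := (MonoidalCategory.tensoringLeft (ModuleCat.{u} A)).obj M
    let C := (F.mapHomologicalComplex (ComplexShape.down ℕ)).obj R.complex
    have e1 : ((Tor (ModuleCat.{u} A) 1).obj M).obj B ≅ C.homology 1 := R.isoLeftDerivedObj F 1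
    have e2 : C.homology 1 ≅ (C.sc' 2 1 0).homology :=
      ShortComplex.homologyMapIso (C.isoSc' 2 1 0 (by simp) (by simp))
    rw [(e1 ≪≫ e2).toLinearEquiv.length_eq]
    refine length_homology_eq (C.sc' 2 1 0) (b.rangeRestrict.lTensor M)
      ((LinearMap.range b).subtype.lTensor M) ?_ ?_ ?_
    · exact LinearMap.lTensor_surjective _ b.surjective_rangeRestrict
    · refine lTensor_exact M ?_ b.surjective_rangeRestrict
      rw [LinearMap.exact_iff, LinearMap.ker_rangeRestrict]
      exact LinearMap.exact_iff.1 hab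
    · exact (LinearMap.lTensor_comp (M := M) (LinearMap.range b).subtype b.rangeRestrict).symm


variable {P : Type u} [AddCommGroup P] [Module A P] (K : Submodule A P)

/-- The kernel of `M ⊗ K → M ⊗ P`; for `P` flat this is `Tor₁(M, P / K)`. -/
abbrev tensorKer (M : Type u) [AddCommGroup M] [Module A M] : Submodule A (M ⊗[A] K) :=
  LinearMap.ker (K.subtype.lTensor M)

variable {L M N : Type u} [AddCommGroup L] [Module A L] [AddCommGroup M] [Module A M]
  [AddCommGroup N] [Module A N]

/-- The map induced by `f : M → N` on `tensorKer`. -/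
def tensorKerMap (f : M →ₗ[A] N) : tensorKer K M →ₗ[A] tensorKer K N :=
  (f.rTensor K).restrict fun x hx => by
    rw [LinearMap.mem_ker] at hx ⊢
    rw [← LinearMap.comp_apply, LinearMap.lTensor_comp_rTensor, ← LinearMap.rTensor_comp_lTensor,
      LinearMap.comp_apply, hx, map_zero]

theorem tensorKerMap_coe (f : M →ₗ[A] N) (x : tensorKer K M) :
    (tensorKerMap K f x : N ⊗[A] K) = f.rTensor K x := rfl

theorem tensorKerMap_comp_apply (g : N →ₗ[A] L) (f : M →ₗ[A] N) (x : tensorKer K M) :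
    tensorKerMap K g (tensorKerMap K f x) = tensorKerMap K (g ∘ₗ f) x :=
  Subtype.ext (LinearMap.rTensor_comp_apply K g f _).symm

theorem tensorKerMap_id (x : tensorKer K M) : tensorKerMap K LinearMap.id x = x :=
  Subtype.ext (by rw [tensorKerMap_coe, LinearMap.rTensor_id_apply])

theorem tensorKerMap_zero (x : tensorKer K M) : tensorKerMap K (0 : M →ₗ[A] N) x = 0 :=
  Subtype.ext (by rw [tensorKerMap_coe, LinearMap.rTensor_zero]; rfl)

/-- `tensorKer` is exact in the middle, as `Tor₁` is. -/
theorem exact_tensorKerMap [Module.Flat A P] (f : L →ₗ[A] M) (g : M →ₗ[A] N)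
    (hf : Function.Injective f) (hg : Function.Surjective g) (hfg : Function.Exact f g) :
    Function.Exact (tensorKerMap K f) (tensorKerMap K g) := by
  intro x
  constructor
  · intro hx
    have hx' : g.rTensor K x = 0 := congrArg Subtype.val hx
    obtain ⟨y, hy⟩ := (rTensor_exact K hfg hg _).1 hx'
    refine ⟨⟨y, ?_⟩, Subtype.ext hy⟩
    apply Module.Flat.rTensor_preserves_injective_linearMap (M := P) f hf
    rw [map_zero, ← LinearMap.comp_apply, LinearMap.rTensor_comp_lTensor,
      ← LinearMap.lTensor_comp_rTensor, LinearMap.comp_apply, hy]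
    exact x.2
  · rintro ⟨y, rfl⟩
    rw [tensorKerMap_comp_apply, hfg.linearMap_comp_eq_zero, tensorKerMap_zero]

theorem length_tensorKer_le [Module.Flat A P] (f : L →ₗ[A] M) (g : M →ₗ[A] N)
    (hf : Function.Injective f) (hg : Function.Surjective g) (hfg : Function.Exact f g) :
    Module.length A (tensorKer K M) ≤
      Module.length A (tensorKer K L) + Module.length A (tensorKer K N) :=
  length_le_add_of_exact _ _ (exact_tensorKerMap K f g hf hg hfg)

theorem length_tensorKer_add_le (i : L →ₗ[A] M) (j : N →ₗ[A] M) (p : M →ₗ[A] L) (q : M →ₗ[A] N)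
    (hpi : p ∘ₗ i = LinearMap.id) (hqj : q ∘ₗ j = LinearMap.id) (hpj : p ∘ₗ j = 0)
    (hqi : q ∘ₗ i = 0) :
    Module.length A (tensorKer K L) + Module.length A (tensorKer K N) ≤
      Module.length A (tensorKer K M) := by
  rw [← Module.length_prod]
  refine Module.length_le_of_injective ((tensorKerMap K i).coprod (tensorKerMap K j))
    (Function.LeftInverse.injective (g := fun x => (tensorKerMap K p x, tensorKerMap K q x)) ?_)
  rintro ⟨x, y⟩
  ext1 <;> simp [map_add, tensorKerMap_comp_apply, hpi, hqj, hpj, hqi, tensorKerMap_id,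
    tensorKerMap_zero]

/-- Dimension shifting: for an exact sequence `0 → L → F → M → 0` with `F` flat, `tensorKer K M` is
the kernel of `L ⊗ P / K → F ⊗ P / K`, by the snake lemma. -/
theorem length_tensorKer_eq [Module.Flat A P] {F : Type u} [AddCommGroup F] [Module A F]
    [Module.Flat A F] (f : L →ₗ[A] F) (g : F →ₗ[A] M)
    (hf : Function.Injective f) (hg : Function.Surjective g) (hfg : Function.Exact f g) :
    Module.length A (tensorKer K M) =
      Module.length A (LinearMap.ker (f.rTensor (P ⧸ K))) := by
  have hι := Submodule.subtype_injective K
  have hK : Function.Exact K.subtype K.mkQ := by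
    rw [LinearMap.exact_iff, Submodule.ker_mkQ, Submodule.range_subtype]
  have hf₁ := rTensor_exact K hfg hg
  have hg₁ := rTensor_exact P hfg hg
  have h₁ : f.rTensor P ∘ₗ K.subtype.lTensor L = K.subtype.lTensor F ∘ₗ f.rTensor K := by
    rw [LinearMap.rTensor_comp_lTensor, LinearMap.lTensor_comp_rTensor]
  have h₂ : g.rTensor P ∘ₗ K.subtype.lTensor F = K.subtype.lTensor M ∘ₗ g.rTensor K := by
    rw [LinearMap.rTensor_comp_lTensor, LinearMap.lTensor_comp_rTensor]
  have hι₃ : Function.Exact (tensorKer K M).subtype (K.subtype.lTensor M) := by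
    rw [LinearMap.exact_iff, Submodule.range_subtype]
  have hι₂ : Function.Exact (0 : PUnit.{u + 1} →ₗ[A] F ⊗[A] K) (K.subtype.lTensor F) := by
    rw [LinearMap.exact_iff, LinearMap.range_zero, LinearMap.ker_eq_bot]
    exact Module.Flat.lTensor_preserves_injective_linearMap (M := F) _ hι
  have hπ₁ := lTensor_exact L hK K.mkQ_surjective
  have hπ₂ := lTensor_exact F hK K.mkQ_surjective
  have hs := LinearMap.rTensor_surjective K hg
  have hinj := Module.Flat.rTensor_preserves_injective_linearMap (M := P) f hf
  have hr := SnakeLemma.exact_δ'_right (K.subtype.lTensor L) (K.subtype.lTensor F)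
    (K.subtype.lTensor M) (f.rTensor K) (g.rTensor K) hf₁ (f.rTensor P) (g.rTensor P) hg₁ h₁ h₂
    (0 : PUnit.{u + 1} →ₗ[A] F ⊗[A] K) hι₂ (tensorKer K M).subtype hι₃ (K.mkQ.lTensor L) hπ₁
    hs hinj (0 : PUnit.{u + 1} →ₗ[A] tensorKer K M) (by simp) (Submodule.subtype_injective _)
  have hl := SnakeLemma.exact_δ'_left (K.subtype.lTensor L) (K.subtype.lTensor F)
    (K.subtype.lTensor M) (f.rTensor K) (g.rTensor K) hf₁ (f.rTensor P) (g.rTensor P) hg₁ h₁ h₂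
    (tensorKer K M).subtype hι₃ (K.mkQ.lTensor L) hπ₁ (K.mkQ.lTensor F) hπ₂
    hs hinj (f.rTensor (P ⧸ K)) (by
      rw [LinearMap.rTensor_comp_lTensor, LinearMap.lTensor_comp_rTensor])
    (LinearMap.lTensor_surjective _ K.mkQ_surjective)
  rw [LinearMap.exact_iff] at hl
  rw [hl]
  refine (LinearEquiv.ofInjective _ ?_).length_eq
  rw [← LinearMap.ker_eq_bot, LinearMap.exact_iff.1 hr, LinearMap.range_zero]

end

/-! ### The length of `Tor₁(M, A / 𝔪ⁿ)` -/

section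
open TensorProduct IsLocalRing
variable {A : Type u} [CommRing A]

variable {L M N F : Type u} [AddCommGroup L] [Module A L] [AddCommGroup M] [Module A M]
  [AddCommGroup N] [Module A N] [AddCommGroup F] [Module A F]

/-- The length of `Tor₁(M, A / J)`. -/
noncomputable def torLength (J : Ideal A) (M : Type u) [AddCommGroup M] [Module A M] : ℕ∞ :=
  Module.length A (((Tor (ModuleCat.{u} A) 1).obj (ModuleCat.of A M)).obj (ModuleCat.of A (A ⧸ J)))

theorem torLength_le (J : Ideal A) (f : L →ₗ[A] M) (g : M →ₗ[A] N) (hf : Function.Injective f)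
    (hg : Function.Surjective g) (hfg : Function.Exact f g) :
    torLength J M ≤ torLength J L + torLength J N := by
  obtain ⟨P, K, _, -, h⟩ := exists_length_tor_eq (ModuleCat.of A (A ⧸ J))
  simpa only [torLength, h] using length_tensorKer_le K f g hf hg hfg

theorem torLength_add_le (J : Ideal A) (i : L →ₗ[A] M) (j : N →ₗ[A] M) (p : M →ₗ[A] L)
    (q : M →ₗ[A] N) (hpi : p ∘ₗ i = LinearMap.id) (hqj : q ∘ₗ j = LinearMap.id)
    (hpj : p ∘ₗ j = 0) (hqi : q ∘ₗ i = 0) :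
    torLength J L + torLength J N ≤ torLength J M := by
  obtain ⟨P, K, _, -, h⟩ := exists_length_tor_eq (ModuleCat.of A (A ⧸ J))
  simpa only [torLength, h] using length_tensorKer_add_le K i j p q hpi hqj hpj hqi

/-- The length of `Tor₁(M, A / J)` from a presentation of `M` rather than a resolution of
`A / J`. -/
theorem torLength_eq (J : Ideal A) [Module.Flat A F] (f : L →ₗ[A] F) (g : F →ₗ[A] M)
    (hf : Function.Injective f) (hg : Function.Surjective g) (hfg : Function.Exact f g) :
    torLength J M = Module.length A (LinearMap.ker (f.rTensor (A ⧸ J))) := by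
  obtain ⟨P, K, _, ⟨e⟩, h⟩ := exists_length_tor_eq (ModuleCat.of A (A ⧸ J))
  rw [torLength, h]
  refine (length_tensorKer_eq K f g hf hg hfg).trans ?_
  have e' : (P ⧸ K) ≃ₗ[A] (A ⧸ J) := e
  have hker : LinearMap.ker (f.rTensor (P ⧸ K)) =
      (LinearMap.ker (f.rTensor (A ⧸ J))).comap (LinearEquiv.lTensor L e').toLinearMap := by
    rw [← LinearMap.ker_comp]
    change _ = LinearMap.ker (f.rTensor (A ⧸ J) ∘ₗ e'.toLinearMap.lTensor L)
    rw [LinearMap.rTensor_comp_lTensor, ← LinearMap.lTensor_comp_rTensor]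
    exact (LinearEquiv.ker_comp (LinearEquiv.lTensor F e') _).symm
  exact ((LinearEquiv.ofEq _ _ hker).trans ((LinearEquiv.lTensor L e').ofSubmodule' _)).length_eq

theorem length_tensor_quotient (J : Ideal A) :
    Module.length A (M ⊗[A] (A ⧸ J)) = Module.length A (M ⧸ (J • ⊤ : Submodule A M)) :=
  (tensorQuotEquivQuotSMul M J).length_eq

theorem tmul_one_eq_zero_iff (J : Ideal A) (m : M) :
    m ⊗ₜ[A] (1 : A ⧸ J) = 0 ↔ m ∈ (J • ⊤ : Submodule A M) := by
  rw [← (tensorQuotEquivQuotSMul M J).map_eq_zero_iff, ← Submodule.Quotient.mk_eq_zero]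
  have := tensorQuotEquivQuotSMul_tmul_mk (M := M) J m 1
  rw [one_smul, map_one] at this
  rw [this]

theorem exists_eq_tmul_one (J : Ideal A) (x : M ⊗[A] (A ⧸ J)) :
    ∃ m : M, x = m ⊗ₜ[A] (1 : A ⧸ J) := by
  obtain ⟨m, hm⟩ := Submodule.Quotient.mk_surjective _ (tensorQuotEquivQuotSMul M J x)
  refine ⟨m, (tensorQuotEquivQuotSMul M J).injective ?_⟩
  have := tensorQuotEquivQuotSMul_tmul_mk (M := M) J m 1
  rw [one_smul, map_one] at this
  rw [this, hm]

theorem torLength_le_length_quotient (J : Ideal A) [Module.Flat A F] (f : L →ₗ[A] F)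
    (g : F →ₗ[A] M) (hf : Function.Injective f) (hg : Function.Surjective g)
    (hfg : Function.Exact f g) :
    torLength J M ≤ Module.length A (L ⧸ (J • ⊤ : Submodule A L)) := by
  rw [torLength_eq J f g hf hg hfg, ← length_tensor_quotient]
  exact Module.length_le_of_injective (LinearMap.ker (f.rTensor (A ⧸ J))).subtype
    (Submodule.subtype_injective _)

/-- Additivity of length along `0 → ker → L ⊗ A / J → F ⊗ A / J → M ⊗ A / J → 0`. -/
theorem length_ker_rTensor_add (J : Ideal A) (f : L →ₗ[A] F) (g : F →ₗ[A] M)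
    (hg : Function.Surjective g) (hfg : Function.Exact f g) :
    Module.length A (LinearMap.ker (f.rTensor (A ⧸ J))) +
        Module.length A (F ⧸ (J • ⊤ : Submodule A F)) =
      Module.length A (L ⧸ (J • ⊤ : Submodule A L)) +
        Module.length A (M ⧸ (J • ⊤ : Submodule A M)) := by
  rw [← length_tensor_quotient, ← length_tensor_quotient, ← length_tensor_quotient]
  let φ := f.rTensor (A ⧸ J)
  have hex := rTensor_exact (A ⧸ J) hfg hg
  have hs := LinearMap.rTensor_surjective (A ⧸ J) hg
  have h1 := Module.length_eq_add_of_exact (LinearMap.ker φ).subtype φ.rangeRestrict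
    (Submodule.subtype_injective _) φ.surjective_rangeRestrict
    (by rw [LinearMap.exact_iff, LinearMap.ker_rangeRestrict, Submodule.range_subtype])
  have h2 := Module.length_eq_add_of_exact (LinearMap.range φ).subtype (g.rTensor (A ⧸ J))
    (Submodule.subtype_injective _) hs
    (by rw [LinearMap.exact_iff, Submodule.range_subtype]; exact LinearMap.exact_iff.1 hex)
  rw [h1, h2, add_assoc]

variable [IsNoetherianRing A] [IsLocalRing A]

theorem isFiniteLength_quotient_maximalIdeal_pow (M : Type u) [AddCommGroup M] [Module A M]
    [Module.Finite A M] (n : ℕ) :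
    IsFiniteLength A (M ⧸ (maximalIdeal A ^ n • ⊤ : Submodule A M)) :=
  isFiniteLength_quotient_pow_smul_top (k := 1) (by rw [pow_one]) M n

theorem torLength_ne_top [Module.Finite A M] (n : ℕ) :
    torLength (maximalIdeal A ^ n) M ≠ ⊤ := by
  obtain ⟨k, g, hg⟩ := Module.Finite.exists_fin' A M
  exact ne_top_of_le_ne_top
    (Module.length_ne_top_iff.2 (isFiniteLength_quotient_maximalIdeal_pow (LinearMap.ker g) n))
    (torLength_le_length_quotient _ (LinearMap.ker g).subtype g (Submodule.subtype_injective _) hg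
      (LinearMap.exact_subtype_ker_map g))

/-- By the Artin–Rees lemma the kernel of `L / 𝔪 ^ n L → F / 𝔪 ^ n F` lies in
`𝔪 ^ (n - c) L / 𝔪 ^ n L`. -/
theorem exists_length_ker_rTensor_add_le [Module.Finite A L] [Module.Finite A F] (f : L →ₗ[A] F)
    (hf : Function.Injective f) :
    ∃ c, ∀ n ≥ c, Module.length A (LinearMap.ker (f.rTensor (A ⧸ maximalIdeal A ^ n))) +
        Module.length A (L ⧸ (maximalIdeal A ^ (n - c) • ⊤ : Submodule A L)) ≤
      Module.length A (L ⧸ (maximalIdeal A ^ n • ⊤ : Submodule A L)) := by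
  obtain ⟨c, hc⟩ := (maximalIdeal A).exists_pow_inf_eq_pow_smul (LinearMap.range f)
  refine ⟨c, fun n hn => ?_⟩
  have hle : maximalIdeal A ^ n ≤ maximalIdeal A ^ (n - c) := Ideal.pow_le_pow_right (by omega)
  let π : (A ⧸ maximalIdeal A ^ n) →ₗ[A] (A ⧸ maximalIdeal A ^ (n - c)) := Submodule.factor hle
  have hπ : Function.Surjective (π.lTensor L) :=
    LinearMap.lTensor_surjective _ (Submodule.factor_surjective hle)
  rw [← length_tensor_quotient, ← length_tensor_quotient,
    Module.length_eq_add_of_exact (LinearMap.ker (π.lTensor L)).subtype (π.lTensor L)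
      (Submodule.subtype_injective _) hπ (by rw [LinearMap.exact_iff, Submodule.range_subtype])]
  refine add_le_add_left (Module.length_le_of_injective
    (Submodule.inclusion (?_ : _ ≤ LinearMap.ker (π.lTensor L)))
    (Submodule.inclusion_injective _)) _
  intro x hx
  obtain ⟨l, rfl⟩ := exists_eq_tmul_one _ x
  rw [LinearMap.mem_ker, LinearMap.rTensor_tmul, tmul_one_eq_zero_iff] at hx
  have h1 : f l ∈ (maximalIdeal A ^ n • ⊤ ⊓ LinearMap.range f : Submodule A F) := ⟨hx, l, rfl⟩
  rw [hc n hn] at h1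
  have h2 : f l ∈ (maximalIdeal A ^ (n - c) • ⊤ : Submodule A L).map f := by
    rw [Submodule.map_smul'', Submodule.map_top]
    exact Submodule.smul_mono le_rfl inf_le_right h1
  obtain ⟨l', hl', h3⟩ := h2
  have h4 : π 1 = 1 := rfl
  rw [LinearMap.mem_ker, LinearMap.lTensor_tmul, h4, tmul_one_eq_zero_iff, ← hf h3]
  exact hl'

variable (M) in
/-- The length of `Tor₁(M, A / 𝔪 ^ n)` is eventually polynomial, of degree less than
`dim A`: polynomiality comes from the four term exact sequence of a presentation
`0 → L → F → M → 0`, and the degree from the Artin–Rees bound by a difference of the Hilbert–Samuel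
function of `L`. -/
theorem isEventuallyPolynomial_torLength [Module.Finite A M] :
    IsEventuallyPolynomial (dimNat A)
      (fun n => ((torLength (maximalIdeal A ^ n) M).toNat : ℚ)) := by
  obtain ⟨k, g, hg⟩ := Module.Finite.exists_fin' A M
  let f := (LinearMap.ker g).subtype
  have hf : Function.Injective f := Submodule.subtype_injective _
  have hfg : Function.Exact f g := by rw [LinearMap.exact_iff, Submodule.range_subtype]
  have hL := isEventuallyPolynomial_hilbertSamuel (A := A) (LinearMap.ker g)
  have hfin (X : Type u) [AddCommGroup X] [Module A X] [Module.Finite A X] (n : ℕ) :=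
    Module.length_ne_top_iff.2 (isFiniteLength_quotient_maximalIdeal_pow (A := A) X n)
  obtain ⟨c, hc⟩ := exists_length_ker_rTensor_add_le f hf
  refine IsEventuallyPolynomial.of_le (D := dimNat A + 1)
    (((hL.add (isEventuallyPolynomial_hilbertSamuel M)).sub
      (isEventuallyPolynomial_hilbertSamuel (Fin k → A))).congr' (Eventually.of_forall fun n => ?_))
    (hL.sub_shift c) (fun n => Nat.cast_nonneg _) ?_
  · have h := length_ker_rTensor_add (maximalIdeal A ^ n) f g hg hfg
    rw [← torLength_eq _ f g hf hg hfg] at h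
    have h' := congrArg ENat.toNat h
    rw [ENat.toNat_add (torLength_ne_top n) (hfin _ n),
      ENat.toNat_add (hfin _ n) (hfin _ n)] at h'
    rw [eq_sub_iff_add_eq]
    exact_mod_cast h'
  · filter_upwards [eventually_ge_atTop c] with n hn
    have h := hc n hn
    rw [← torLength_eq _ f g hf hg hfg] at h
    have h' := ENat.toNat_le_toNat h (hfin _ n)
    rw [ENat.toNat_add (torLength_ne_top n) (hfin _ _)] at h'
    rw [le_sub_iff_add_le]
    exact_mod_cast h'

end

/-! ### The invariant `e^T` -/

section
variable {A : Type u} [CommRing A] [IsLocalRing A]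

theorem eTSeq_eq (M : ModuleCat.{u} A) (n : ℕ) :
    eTSeq M n = ((dimNat A - 1).factorial : ℝ) / (n : ℝ) ^ (dimNat A - 1) *
      ((torLength (IsLocalRing.maximalIdeal A ^ (n + 1)) M).toNat : ℝ) := rfl

variable [IsNoetherianRing A]

theorem exists_tendsto_eTSeq (hd : 1 ≤ ringKrullDim A) (M : ModuleCat.{u} A) [Module.Finite A M] :
    ∃ l : ℝ, Tendsto (eTSeq M) atTop (𝓝 l) := by
  have h1 : dimNat A - 1 + 1 = dimNat A := by
    rw [← dimNat_cast] at hd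
    have : 1 ≤ dimNat A := by exact_mod_cast hd
    omega
  have h2 := (isEventuallyPolynomial_torLength M (A := A)).comp_add 1
  rw [← h1] at h2
  obtain ⟨l, hl⟩ := h2.tendsto_div_pow
  refine ⟨(dimNat A - 1).factorial * l, (hl.const_mul _).congr fun n => ?_⟩
  rw [eTSeq_eq]
  push_cast
  ring

theorem tendsto_eTSeq (hd : 1 ≤ ringKrullDim A) (M : ModuleCat.{u} A) [Module.Finite A M] :
    Tendsto (eTSeq M) atTop (𝓝 (eT M)) :=
  tendsto_nhds_limUnder (exists_tendsto_eTSeq hd M)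

/-- Subadditivity of `e^T` along short exact sequences. -/
theorem eT_le_add (hd : 1 ≤ ringKrullDim A) (S : ShortComplex (ModuleCat.{u} A))
    (hS : S.ShortExact) [Module.Finite A S.X₁] [Module.Finite A S.X₂] [Module.Finite A S.X₃] :
    eT S.X₂ ≤ eT S.X₁ + eT S.X₃ := by
  refine le_of_tendsto_of_tendsto' (tendsto_eTSeq hd _)
    ((tendsto_eTSeq hd S.X₁).add (tendsto_eTSeq hd S.X₃)) fun n => ?_
  rw [eTSeq_eq, eTSeq_eq, eTSeq_eq, ← mul_add]
  refine mul_le_mul_of_nonneg_left ?_ (by positivity)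
  have h := ENat.toNat_le_toNat (torLength_le (IsLocalRing.maximalIdeal A ^ (n + 1)) S.f.hom S.g.hom
    hS.moduleCat_injective_f hS.moduleCat_surjective_g
    ((ShortComplex.ShortExact.moduleCat_exact_iff_function_exact S).1 hS.exact))
    (WithTop.add_ne_top.2 ⟨torLength_ne_top _, torLength_ne_top _⟩)
  rw [ENat.toNat_add (torLength_ne_top _) (torLength_ne_top _)] at h
  exact_mod_cast h

/-- Superadditivity of `e^T` on direct sums. -/
theorem eT_add_le (hd : 1 ≤ ringKrullDim A) (M N : Type u) [AddCommGroup M] [AddCommGroup N]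
    [Module A M] [Module A N] [Module.Finite A M] [Module.Finite A N] :
    eT (ModuleCat.of A M) + eT (ModuleCat.of A N) ≤ eT (ModuleCat.of A (M × N)) := by
  refine le_of_tendsto_of_tendsto' ((tendsto_eTSeq hd (ModuleCat.of A M)).add
    (tendsto_eTSeq hd (ModuleCat.of A N))) (tendsto_eTSeq hd _) fun n => ?_
  rw [eTSeq_eq, eTSeq_eq, eTSeq_eq, ← mul_add]
  refine mul_le_mul_of_nonneg_left ?_ (by positivity)
  have h := ENat.toNat_le_toNat (torLength_add_le (IsLocalRing.maximalIdeal A ^ (n + 1))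
    (LinearMap.inl A M N) (LinearMap.inr A M N) (LinearMap.fst A M N) (LinearMap.snd A M N)
    rfl rfl rfl rfl) (torLength_ne_top _)
  rw [ENat.toNat_add (torLength_ne_top _) (torLength_ne_top _)] at h
  exact_mod_cast h

end

/-! ### Operations on `T`-split extensions -/

section
variable {A : Type u} [CommRing A]

theorem ext_comp_mk₀_comp {X Y Z W : ModuleCat.{u} A} (e : Ext X Y 1) (u : Y ⟶ Z) (g : Z ⟶ W) :
    e.comp (Ext.mk₀ (u ≫ g)) (add_zero 1) =
      (e.comp (Ext.mk₀ u) (add_zero 1)).comp (Ext.mk₀ g) (add_zero 1) := by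
  rw [Ext.comp_assoc_of_third_deg_zero, Ext.mk₀_comp_mk₀]

/-- The split exact sequence `0 → N → N × M → M → 0`. -/
abbrev prodSequence (N M : ModuleCat.{u} A) : ShortComplex (ModuleCat.{u} A) :=
  ShortComplex.mk (X₁ := N) (X₂ := ModuleCat.of A (N × M)) (X₃ := M)
    (ModuleCat.ofHom (LinearMap.inl A N M)) (ModuleCat.ofHom (LinearMap.snd A N M)) (by
      ext1
      exact (Function.Exact.inl_snd (R := A) (M := N) (N := M)).linearMap_comp_eq_zero)

theorem prodSequence_shortExact (N M : ModuleCat.{u} A) : (prodSequence N M).ShortExact :=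
  ModuleCat.shortComplex_shortExact _ Function.Exact.inl_snd
    LinearMap.inl_injective LinearMap.snd_surjective

end

section
variable {A : Type u} [CommRing A]

theorem finite_of_shortExact [IsNoetherianRing A] {S : ShortComplex (ModuleCat.{u} A)}
    (hS : S.ShortExact)
    [Module.Finite A S.X₁] [Module.Finite A S.X₃] : Module.Finite A S.X₂ := by
  have : IsNoetherian A S.X₂ := isNoetherian_of_range_eq_ker S.f.hom S.g.hom
    hS.exact.moduleCat_range_eq_ker
  infer_instance

variable [IsLocalRing A]

theorem IsTSplit.exists_shortExact {M N : ModuleCat.{u} A} {α : Ext M N 1} (h : IsTSplit α) :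
    ∃ (E : ModuleCat.{u} A) (i : N ⟶ E) (p : E ⟶ M) (w : i ≫ p = 0)
      (h : (ShortComplex.mk i p w).ShortExact), h.extClass = α ∧ eT M + eT N = eT E := by
  obtain ⟨E, i, p, w, h, hα, he⟩ := h
  exact ⟨E, i, p, w, h, hα, by linarith⟩

variable [IsNoetherianRing A]

/-- Subadditivity of `e^T` makes the inequality `e^T(M) + e^T(N) ≤ e^T(E)` sufficient for an
extension to be `T`-split. -/
theorem isTSplit_extClass (hd : 1 ≤ ringKrullDim A) {S : ShortComplex (ModuleCat.{u} A)}
    (hS : S.ShortExact) [Module.Finite A S.X₁] [Module.Finite A S.X₃]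
    (h : eT S.X₃ + eT S.X₁ ≤ eT S.X₂) : IsTSplit hS.extClass := by
  have := finite_of_shortExact hS
  have := eT_le_add hd S hS
  exact ⟨S.X₂, S.f, S.g, S.zero, hS, rfl, by linarith⟩

variable {M N : ModuleCat.{u} A} [Module.Finite A M] [Module.Finite A N]

/-- The `T`-split classes are stable under pushout: the pushout `E₁` of `E` along `g` sits in
`0 → N → E ⊕ N₁ → E₁ → 0`, whence `e^T(E) + e^T(N₁) ≤ e^T(N) + e^T(E₁)`. -/
theorem IsTSplit.comp_mk₀ (hd : 1 ≤ ringKrullDim A) {α : Ext M N 1} (hα : IsTSplit α)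
    {N₁ : ModuleCat.{u} A} [Module.Finite A N₁] (g : N ⟶ N₁) :
    IsTSplit (α.comp (Ext.mk₀ g) (add_zero 1)) := by
  obtain ⟨E, i, p, w, h, rfl, he⟩ := hα.exists_shortExact
  have hE : Module.Finite A E := finite_of_shortExact (S := ShortComplex.mk i p w) h
  have hi : Function.Injective i.hom := h.moduleCat_injective_f
  have hp : Function.Surjective p.hom := h.moduleCat_surjective_g
  have hip : Function.Exact i.hom p.hom :=
    (ShortComplex.ShortExact.moduleCat_exact_iff_function_exact _).1 h.exact
  let κ : N →ₗ[A] E × N₁ := i.hom.prod (-g.hom)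
  let i₁ : N₁ →ₗ[A] ((E × N₁) ⧸ LinearMap.range κ) :=
    (LinearMap.range κ).mkQ ∘ₗ LinearMap.inr A E N₁
  let p₁ : ((E × N₁) ⧸ LinearMap.range κ) →ₗ[A] M :=
    (LinearMap.range κ).liftQ (p.hom ∘ₗ LinearMap.fst A E N₁) (by
      rintro _ ⟨n, rfl⟩
      exact hip.apply_apply_eq_zero n)
  have hi₁ : Function.Injective i₁ := by
    rw [injective_iff_map_eq_zero]
    intro y hy
    obtain ⟨n, hn⟩ := (Submodule.Quotient.mk_eq_zero _).1 hy
    have h1 : i.hom n = 0 := congrArg Prod.fst hn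
    have h2 : -g.hom n = y := congrArg Prod.snd hn
    rw [hi (h1.trans (map_zero i.hom).symm), map_zero, neg_zero] at h2
    exact h2.symm
  have hp₁ : Function.Surjective p₁ := fun m => by
    obtain ⟨e, rfl⟩ := hp m
    exact ⟨Submodule.Quotient.mk (e, 0), rfl⟩
  have hex : Function.Exact i₁ p₁ := by
    intro z
    obtain ⟨⟨e, y⟩, rfl⟩ := Submodule.Quotient.mk_surjective _ z
    constructor
    · intro hz
      obtain ⟨n, rfl⟩ := (hip e).1 hz
      refine ⟨y + g.hom n, (Submodule.Quotient.eq _).2 ⟨-n, ?_⟩⟩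
      ext <;> simp [κ]
    · rintro ⟨y', hy'⟩
      rw [← hy']
      exact map_zero p.hom
  let S₁ := ModuleCat.shortComplexOfCompEqZero i₁ p₁ hex.linearMap_comp_eq_zero
  have hS₁ : S₁.ShortExact := ModuleCat.shortComplex_shortExact S₁ hex hi₁ hp₁
  let φ : ShortComplex.mk i p w ⟶ S₁ :=
    { τ₁ := g
      τ₂ := ModuleCat.ofHom ((LinearMap.range κ).mkQ ∘ₗ LinearMap.inl A E N₁)
      τ₃ := 𝟙 M
      comm₁₂ := by
        ext n
        refine (Submodule.Quotient.eq _).2 ⟨-n, ?_⟩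
        ext
        · simp [κ]
          rfl
        · simp [κ]
          rfl
      comm₂₃ := by
        ext e
        rfl }
  have hnat := ShortComplex.ShortExact.extClass_naturality h hS₁ φ
  have hclass : h.extClass.comp (Ext.mk₀ g) (add_zero 1) = hS₁.extClass :=
    hnat.trans (Ext.mk₀_id_comp _)
  rw [hclass]
  have : Module.Finite A S₁.X₁ := ‹Module.Finite A N₁›
  have : Module.Finite A S₁.X₃ := ‹Module.Finite A M›
  have : Module.Finite A S₁.X₂ := finite_of_shortExact hS₁
  refine isTSplit_extClass hd hS₁ ?_
  let S₂ := ModuleCat.shortComplexOfCompEqZero κ (LinearMap.range κ).mkQ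
    κ.exact_map_mkQ_range.linearMap_comp_eq_zero
  have hS₂ : S₂.ShortExact := ModuleCat.shortComplex_shortExact S₂ κ.exact_map_mkQ_range
    (fun x y hxy => hi (congrArg Prod.fst hxy)) (Submodule.mkQ_surjective _)
  have : Module.Finite A S₂.X₁ := ‹Module.Finite A N›
  have : Module.Finite A S₂.X₃ := ‹Module.Finite A S₁.X₂›
  have : Module.Finite A S₂.X₂ := finite_of_shortExact hS₂
  have h1 : eT (ModuleCat.of A (E × N₁)) ≤ eT N + eT S₁.X₂ := eT_le_add hd S₂ hS₂
  have h2 : eT E + eT N₁ ≤ eT (ModuleCat.of A (E × N₁)) := eT_add_le hd E N₁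
  change eT M + eT N₁ ≤ eT S₁.X₂
  linarith

/-- The `T`-split classes are stable under pullback: the pullback `E₁` of `E` along `f` sits in
`0 → E₁ → E ⊕ M₁ → M → 0`, whence `e^T(E) + e^T(M₁) ≤ e^T(E₁) + e^T(M)`. -/
theorem IsTSplit.mk₀_comp (hd : 1 ≤ ringKrullDim A) {α : Ext M N 1} (hα : IsTSplit α)
    {M₁ : ModuleCat.{u} A} [Module.Finite A M₁] (f : M₁ ⟶ M) :
    IsTSplit ((Ext.mk₀ f).comp α (zero_add 1)) := by
  obtain ⟨E, i, p, w, h, rfl, he⟩ := hα.exists_shortExact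
  have hE : Module.Finite A E := finite_of_shortExact (S := ShortComplex.mk i p w) h
  have hi : Function.Injective i.hom := h.moduleCat_injective_f
  have hp : Function.Surjective p.hom := h.moduleCat_surjective_g
  have hip : Function.Exact i.hom p.hom :=
    (ShortComplex.ShortExact.moduleCat_exact_iff_function_exact _).1 h.exact
  let δ : E × M₁ →ₗ[A] M := p.hom.coprod (-f.hom)
  let i₁ : N →ₗ[A] LinearMap.ker δ := (LinearMap.inl A E M₁ ∘ₗ i.hom).codRestrict _ fun n => by
    simpa [δ] using hip.apply_apply_eq_zero n
  let p₁ : LinearMap.ker δ →ₗ[A] M₁ := LinearMap.snd A E M₁ ∘ₗ (LinearMap.ker δ).subtype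
  have hδ : ∀ e m, (e, m) ∈ LinearMap.ker δ ↔ p.hom e = f.hom m := fun e m => by
    rw [LinearMap.mem_ker, LinearMap.coprod_apply, LinearMap.neg_apply, ← sub_eq_add_neg,
      sub_eq_zero]
  have hi₁ : Function.Injective i₁ := fun x y hxy =>
    hi (congrArg (fun z : LinearMap.ker δ => z.1.1) hxy)
  have hp₁ : Function.Surjective p₁ := fun m => by
    obtain ⟨e, he⟩ := hp (f.hom m)
    exact ⟨⟨(e, m), (hδ e m).2 he⟩, rfl⟩
  have hex : Function.Exact i₁ p₁ := by
    rintro ⟨⟨e, m⟩, hem⟩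
    constructor
    · intro hz
      obtain rfl : m = 0 := hz
      obtain ⟨n, rfl⟩ := (hip e).1 (((hδ e 0).1 hem).trans (map_zero f.hom))
      exact ⟨n, rfl⟩
    · rintro ⟨n, hn⟩
      rw [← hn]
      rfl
  let S₁ := ModuleCat.shortComplexOfCompEqZero i₁ p₁ hex.linearMap_comp_eq_zero
  have hS₁ : S₁.ShortExact := ModuleCat.shortComplex_shortExact S₁ hex hi₁ hp₁
  let φ : S₁ ⟶ ShortComplex.mk i p w :=
    { τ₁ := 𝟙 N
      τ₂ := ModuleCat.ofHom (LinearMap.fst A E M₁ ∘ₗ (LinearMap.ker δ).subtype)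
      τ₃ := f
      comm₁₂ := by
        ext n
        rfl
      comm₂₃ := by
        ext ⟨⟨e, m⟩, hem⟩
        exact (hδ e m).1 hem }
  have hnat := ShortComplex.ShortExact.extClass_naturality hS₁ h φ
  have hclass : (Ext.mk₀ f).comp h.extClass (zero_add 1) = hS₁.extClass :=
    hnat.symm.trans (Ext.comp_mk₀_id _)
  rw [hclass]
  have : Module.Finite A S₁.X₁ := ‹Module.Finite A N›
  have : Module.Finite A S₁.X₃ := ‹Module.Finite A M₁›
  have : Module.Finite A S₁.X₂ := finite_of_shortExact hS₁
  refine isTSplit_extClass hd hS₁ ?_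
  have hδs : Function.Surjective δ := fun m => by
    obtain ⟨e, rfl⟩ := hp m
    exact ⟨(e, 0), by simp [δ]⟩
  have hδx : Function.Exact (LinearMap.ker δ).subtype δ := by
    rw [LinearMap.exact_iff, Submodule.range_subtype]
  let S₂ := ModuleCat.shortComplexOfCompEqZero (LinearMap.ker δ).subtype δ
    hδx.linearMap_comp_eq_zero
  have hS₂ : S₂.ShortExact := ModuleCat.shortComplex_shortExact S₂ hδx
    (Submodule.subtype_injective _) hδs
  have : Module.Finite A S₂.X₁ := ‹Module.Finite A S₁.X₂›
  have : Module.Finite A S₂.X₃ := ‹Module.Finite A M›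
  have : Module.Finite A S₂.X₂ := finite_of_shortExact hS₂
  have h1 : eT (ModuleCat.of A (E × M₁)) ≤ eT S₁.X₂ + eT M := eT_le_add hd S₂ hS₂
  have h2 : eT E + eT M₁ ≤ eT (ModuleCat.of A (E × M₁)) := eT_add_le hd E M₁
  change eT M₁ + eT N ≤ eT S₁.X₂
  linarith

variable (M N) in
theorem eT_prod_le (hd : 1 ≤ ringKrullDim A) :
    eT (ModuleCat.of A (N × M)) ≤ eT N + eT M := by
  have : Module.Finite A (prodSequence N M).X₂ := inferInstanceAs (Module.Finite A (N × M))
  exact eT_le_add hd (prodSequence N M) (prodSequence_shortExact N M)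

variable (M N) in
theorem isTSplit_zero (hd : 1 ≤ ringKrullDim A) : IsTSplit (0 : Ext M N 1) := by
  -- The zero class is the pushout of the split extension along the zero map.
  have h := (isTSplit_extClass hd (prodSequence_shortExact N M)
    (by rw [add_comm]; exact eT_add_le hd N M)).comp_mk₀ hd (0 : N ⟶ N)
  rwa [Ext.mk₀_zero, Ext.comp_zero] at h

theorem IsTSplit.smul (hd : 1 ≤ ringKrullDim A) {α : Ext M N 1} (hα : IsTSplit α) (a : A) :
    IsTSplit (a • α) := by
  have h := hα.comp_mk₀ hd (a • 𝟙 N)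
  rwa [Ext.mk₀_smul, Ext.comp_smul, Ext.comp_mk₀_id] at h

/-- The sum of two classes is the direct sum of the extensions, pulled back along the diagonal and
pushed out along the codiagonal (Baer sum). -/
theorem IsTSplit.add (hd : 1 ≤ ringKrullDim A) {α β : Ext M N 1} (hα : IsTSplit α)
    (hβ : IsTSplit β) : IsTSplit (α + β) := by
  obtain ⟨E, i, p, w, h, rfl, he⟩ := hα.exists_shortExact
  obtain ⟨E', i', p', w', h', rfl, he'⟩ := hβ.exists_shortExact
  have : Module.Finite A E := finite_of_shortExact (S := ShortComplex.mk i p w) h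
  have : Module.Finite A E' := finite_of_shortExact (S := ShortComplex.mk i' p' w') h'
  have hip : Function.Exact i.hom p.hom :=
    (ShortComplex.ShortExact.moduleCat_exact_iff_function_exact _).1 h.exact
  have hip' : Function.Exact i'.hom p'.hom :=
    (ShortComplex.ShortExact.moduleCat_exact_iff_function_exact _).1 h'.exact
  have hex : Function.Exact (i.hom.prodMap i'.hom) (p.hom.prodMap p'.hom) := by
    rintro ⟨e, e'⟩
    constructor
    · intro hz
      obtain ⟨n, hn⟩ := (hip e).1 (congrArg Prod.fst hz)
      obtain ⟨n', hn'⟩ := (hip' e').1 (congrArg Prod.snd hz)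
      exact ⟨(n, n'), Prod.ext hn hn'⟩
    · rintro ⟨⟨n, n'⟩, hn⟩
      rw [← hn]
      exact Prod.ext (hip.apply_apply_eq_zero n) (hip'.apply_apply_eq_zero n')
  let S := ModuleCat.shortComplexOfCompEqZero _ _ hex.linearMap_comp_eq_zero
  have hS : S.ShortExact := ModuleCat.shortComplex_shortExact S hex
    (h.moduleCat_injective_f.prodMap h'.moduleCat_injective_f)
    (h.moduleCat_surjective_g.prodMap h'.moduleCat_surjective_g)
  have : Module.Finite A S.X₁ := inferInstanceAs (Module.Finite A (N × N))
  have : Module.Finite A S.X₃ := inferInstanceAs (Module.Finite A (M × M))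
  have : Module.Finite A S.X₂ := finite_of_shortExact hS
  have hδ : IsTSplit (M := ModuleCat.of A (M × M)) (N := ModuleCat.of A (N × N)) hS.extClass := by
    refine isTSplit_extClass hd hS ?_
    have h1 := eT_prod_le M M hd
    have h2 := eT_prod_le N N hd
    have h3 := eT_add_le hd E E'
    change eT (ModuleCat.of A (M × M)) + eT (ModuleCat.of A (N × N)) ≤ eT (ModuleCat.of A (E × E'))
    linarith
  let c : ModuleCat.of A (N × N) ⟶ N := ModuleCat.ofHom (LinearMap.id.coprod LinearMap.id)
  -- The codiagonal retracts both inclusions of `N`, so pushing out along it undoes their effect.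
  have key : ∀ (α : Ext M N 1) (j : N ⟶ ModuleCat.of A (N × N)) (k : M ⟶ ModuleCat.of A (M × M)),
      j ≫ c = 𝟙 N → α.comp (Ext.mk₀ j) (add_zero 1) = (Ext.mk₀ k).comp hS.extClass (zero_add 1) →
      (Ext.mk₀ k).comp (hS.extClass.comp (Ext.mk₀ c) (add_zero 1)) (zero_add 1) = α := by
    intro α j k hj hk
    rw [← Ext.comp_assoc_of_third_deg_zero, ← hk]
    refine (ext_comp_mk₀_comp α j c).symm.trans ?_
    rw [hj, Ext.comp_mk₀_id]
  let φ : ShortComplex.mk i p w ⟶ S :=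
    { τ₁ := ModuleCat.ofHom (LinearMap.inl A N N)
      τ₂ := ModuleCat.ofHom (LinearMap.inl A E E')
      τ₃ := ModuleCat.ofHom (LinearMap.inl A M M)
      comm₁₂ := by
        ext n : 2
        exact Prod.ext rfl (map_zero i'.hom)
      comm₂₃ := by
        ext n : 2
        exact Prod.ext rfl (map_zero p'.hom) }
  let φ' : ShortComplex.mk i' p' w' ⟶ S :=
    { τ₁ := ModuleCat.ofHom (LinearMap.inr A N N)
      τ₂ := ModuleCat.ofHom (LinearMap.inr A E E')
      τ₃ := ModuleCat.ofHom (LinearMap.inr A M M)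
      comm₁₂ := by
        ext n : 2
        exact Prod.ext (map_zero i.hom) rfl
      comm₂₃ := by
        ext n : 2
        exact Prod.ext (map_zero p.hom) rfl }
  have e := key h.extClass φ.τ₁ φ.τ₃ (by ext n : 2; exact add_zero n)
    (ShortComplex.ShortExact.extClass_naturality h hS φ)
  have e' := key h'.extClass φ'.τ₁ φ'.τ₃ (by ext n : 2; exact zero_add n)
    (ShortComplex.ShortExact.extClass_naturality h' hS φ')
  have hsum := (hδ.comp_mk₀ hd c).mk₀_comp hd (φ.τ₃ + φ'.τ₃)
  rw [Ext.mk₀_add, Ext.add_comp] at hsum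
  have hadd := congrArg₂ (· + ·) e e'
  exact hadd ▸ hsum

end

/-! ### The relation on the stable category -/

section
variable {A : Type u} [CommRing A] [IsGorensteinLocalRing A]

instance finite_cosyzygy (M : StableCM A) : Module.Finite A (cosyzygy M) :=
  inferInstanceAs (Module.Finite A ((Fin (dualRank M.obj) → A) ⧸ LinearMap.range (cosyzygyMap M)))

/-- A linear map `M → N` extends to the co-syzygy sequences, because every functional on `M` extends
to the free module of the co-syzygy sequence of `M`. -/
theorem exists_cosyzygySequence_hom {M N : StableCM A} (f : M.obj ⟶ N.obj) :
    ∃ φ : cosyzygySequence M ⟶ cosyzygySequence N, φ.τ₁ = f := by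
  choose ψ hψ using fun i : Fin (dualRank N.obj) =>
    exists_comp_cosyzygyMap M (LinearMap.proj i ∘ₗ cosyzygyMap N ∘ₗ f.hom)
  have h : LinearMap.pi ψ ∘ₗ cosyzygyMap M = cosyzygyMap N ∘ₗ f.hom := by
    ext m i
    exact congrArg (fun t => t m) (hψ i)
  refine ⟨
    { τ₁ := f
      τ₂ := ModuleCat.ofHom (LinearMap.pi ψ)
      τ₃ := ModuleCat.ofHom (Submodule.mapQ _ _ (LinearMap.pi ψ) ?_)
      comm₁₂ := ?_
      comm₂₃ := ?_ }, rfl⟩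
  · rintro _ ⟨m, rfl⟩
    exact ⟨f.hom m, (LinearMap.congr_fun h m).symm⟩
  · ext m : 2
    exact (LinearMap.congr_fun h m).symm
  · ext m : 2
    rfl

theorem eta_comp (M N L : StableCM A) (u : M ⟶ N) (g : N.obj ⟶ L.obj) :
    eta M L (u ≫ (Submodule.Quotient.mk g : StableHom N.obj L.obj)) =
      (eta M N u).comp (Ext.mk₀ g) (add_zero 1) := by
  obtain ⟨u, rfl⟩ := Submodule.Quotient.mk_surjective _ u
  change pushoutClass M L (u ≫ g) = (pushoutClass M N u).comp (Ext.mk₀ g) (add_zero 1)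
  exact ext_comp_mk₀_comp (Y := M.obj) _ u g

/-- Under `η`, precomposition with a stable map is precomposition with the induced map of
co-syzygies. -/
theorem exists_comp_eta (L M N : StableCM A) (f : L ⟶ M) :
    ∃ f' : cosyzygy L ⟶ cosyzygy M, ∀ u : M ⟶ N,
      eta L N (f ≫ u) = (Ext.mk₀ f').comp (eta M N u) (zero_add 1) := by
  obtain ⟨f, rfl⟩ := Submodule.Quotient.mk_surjective _ f
  obtain ⟨φ, rfl⟩ := exists_cosyzygySequence_hom f
  refine ⟨φ.τ₃, fun u => ?_⟩
  obtain ⟨u, rfl⟩ := Submodule.Quotient.mk_surjective _ u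
  change pushoutClass L N (φ.τ₁ ≫ u) = (Ext.mk₀ φ.τ₃).comp (pushoutClass M N u) (zero_add 1)
  rw [pushoutClass_apply, pushoutClass_apply]
  refine (ext_comp_mk₀_comp (Y := L.obj) (Z := M.obj) _ φ.τ₁ u).trans ?_
  have hφ := ShortComplex.ShortExact.extClass_naturality (cosyzygySequence_shortExact L)
    (cosyzygySequence_shortExact M) φ
  refine (congrArg (fun e : Ext (cosyzygy L) M.obj 1 =>
    e.comp (Ext.mk₀ u) (add_zero 1)) hφ).trans ?_
  exact Ext.comp_assoc_of_third_deg_zero _ _ _ _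

theorem isRelation_tSplitRelation (hd : 1 ≤ ringKrullDim A) :
    IsRelation A (tSplitRelation A) := by
  have (M : StableCM A) : Module.Finite A M.obj := M.isMCM.1
  constructor
  · intro M N
    change IsTSplit (eta M N 0)
    rw [map_zero]
    exact isTSplit_zero _ _ hd
  · intro M N u v hu hv
    change IsTSplit (eta M N (u + v))
    rw [map_add]
    exact IsTSplit.add hd hu hv
  · intro M N a u hu
    change IsTSplit (eta M N (a • u))
    rw [map_smul]
    exact IsTSplit.smul hd hu a
  · intro L M N f u hu
    obtain ⟨f', hf'⟩ := exists_comp_eta L M N f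
    change IsTSplit (eta L N (f ≫ u))
    rw [hf']
    exact IsTSplit.mk₀_comp hd hu f'
  · intro M N L u g hu
    obtain ⟨g, rfl⟩ := Submodule.Quotient.mk_surjective _ g
    change IsTSplit (eta M L (u ≫ _))
    rw [eta_comp]
    exact IsTSplit.comp_mk₀ hd hu g

end

theorem proposition1p4 (A : Type u) [CommRing A] [IsGorensteinLocalRing A]
    (hd : 1 ≤ ringKrullDim A) :
    (∀ M : StableCM A, ∃ l : ℝ, Tendsto (eTSeq M.obj) atTop (𝓝 l)) ∧
      IsRelation A (tSplitRelation A) := by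
  refine ⟨fun M => ?_, isRelation_tSplitRelation hd⟩
  have := M.isMCM.1
  exact exists_tendsto_eTSeq hd M.obj
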